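/- Notation. Indices run over $\{1,2,3,\dots\}$ and scalars are real. The Schreier families are defined by $\mathcal S_0=\{\{n\}:n\ge1\}\cup\{\emptyset\}$ and, for $N\ge0$, $\mathcal S_{N+1}$ consists of $\emptyset$ and of all unions $E_1\cup\dots\cup E_k$ of non-empty sets $E_1<\dots<E_k$ from $\mathcal S_N$ with $k\le\min E_1$ (here $E<F$ means $\max E<\min F$). The Schreier space $X[\mathcal S_N]$ is the completion of $c_{00}$ with the norm $\|(x_n)_n\|_{\mathcal S_N}=\sup_{\emptyset\ne A\in\mathcal S_N}\sum_{n\in A}|x_n|$; $(\tilde e_n)_n$ is its unit vector basis, and for $I\subset\{1,2,\dots\}$, $P_I$ is the canonical projection of $X[\mathcal S_N]$ onto the closed span of $(\tilde e_n)_{n\in I}$. A sequence $(x_n)_n$ dominates a sequence $(y_n)_n$ if there is a constant $C$ with $\|\sum_n a_ny_n\|\le C\|\sum_n a_nx_n\|$ for all finitely supported scalar sequences $(a_n)_n$; families indexed by an infinite set of positive integers are read as sequences through the increasing enumeration of the index set. An operator ideal in the algebra $\mathscr B(X)$ of bounded operators on a Banach space $X$ is a linear subspace that is a two-sided ideal and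 contains all finite-rank operators; the closed operator ideal generated by a family is the smallest operator ideal that contains it and is closed in the operator norm. Proposition. Let $N\ge1$ and let $(e_n)_n$ be a normalized sequence in $X[\mathcal S_N]$ that is equivalent to the unit vector basis of $c_0$. Let $T$ be the bounded operator on $X[\mathcal S_N]$ with $T\tilde e_n=e_n$ for all $n$, and put $T_I=T\circ P_I$ for every infinite $I\subset\{1,2,\dots\}$. Let $I\subset\{1,2,\dots\}$ be infinite and let $\mathcal J$ be a family of infinite subsets of $\{1,2,\dots\}$. Assume that for all $k\ge1$ and all $J_1,\dots,J_k\in\mathcal J$ the sequence $(\tilde e_i)_{i\in I}$ does not dominate the sequence $(\tilde e_j)_{j\in J}$, where $J=J_1\cup\dots\cup J_k$. Then $\|T_I-Q\|\ge1$ for every $Q$ in the closed operator ideal of $\mathscr B(X[\mathcal S_N])$ generated by $\{T_J:J\in\mathcal J\}$. -/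

import Mathlib

noncomputable section

namespace Schreier

/-- The Schreier families `S_N` of finite subsets of `{1, 2, 3, …}`: `S_0` consists of the singletons
and the empty set; `S_{N+1}` consists of the empty set and of the unions `E_1 ∪ … ∪ E_k` of
non-empty `E_1 < … < E_k` in `S_N` with `k ≤ min E_1`. (As `E_1 < … < E_k`, the last condition says
that `k ≤ n` for all `n` in all the `E_i`.) -/
def family : ℕ → Set (Finset ℕ+)
  | 0 => {F | F = ∅ ∨ ∃ n : ℕ+, F = {n}}
  | N + 1 => {F | F = ∅ ∨ ∃ (k : ℕ) (E : Fin k → Finset ℕ+),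
      (∀ i, E i ∈ family N) ∧ (∀ i, (E i).Nonempty) ∧
      (∀ i, ∀ n ∈ E i, k ≤ (n : ℕ)) ∧
      (∀ i j, i < j → ∀ a ∈ E i, ∀ b ∈ E j, a < b) ∧
      F = Finset.univ.biUnion E}

theorem singleton_mem_family (N : ℕ) (n : ℕ+) : ({n} : Finset ℕ+) ∈ family N := by
  induction N with
  | zero => exact Or.inr ⟨n, rfl⟩
  | succ N ih =>
    refine Or.inr ⟨1, fun _ => {n}, fun _ => ih, fun _ => Finset.singleton_nonempty n, ?_, ?_, ?_⟩
    · intro i m _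
      exact m.pos
    · intro i j hij
      exact absurd hij (by simp [Subsingleton.elim i j])
    · simp

/-- The space `c_00` of finitely supported real sequences `(x_n)_{n ≥ 1}`; the parameter `N` only
records which norm is put on it. -/
def C00 (_N : ℕ) : Type := ℕ+ →₀ ℝ

instance (N : ℕ) : AddCommGroup (C00 N) := inferInstanceAs (AddCommGroup (ℕ+ →₀ ℝ))
instance (N : ℕ) : Module ℝ (C00 N) := inferInstanceAs (Module ℝ (ℕ+ →₀ ℝ))

/-- The identification of `c_00` with the finitely supported functions. -/
def C00.toFinsupp (N : ℕ) : C00 N ≃ₗ[ℝ] (ℕ+ →₀ ℝ) := LinearEquiv.refl ℝ (ℕ+ →₀ ℝ)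

/-- The `n`-th coordinate of a finitely supported sequence. -/
def C00.coord {N : ℕ} (x : C00 N) (n : ℕ+) : ℝ := C00.toFinsupp N x n

/-- The unit vectors of `c_00`. -/
def C00.single (N : ℕ) (n : ℕ+) : C00 N := (C00.toFinsupp N).symm (Finsupp.single n 1)

/-- The Schreier norm `sup { ∑_{n ∈ A} |x_n| : A ∈ S_N, A ≠ ∅ }` on `c_00`. -/
instance (N : ℕ) : Norm (C00 N) :=
  ⟨fun x => ⨆ A : {A : Finset ℕ+ // A ∈ family N ∧ A.Nonempty}, ∑ n ∈ A.1, |x.coord n|⟩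

theorem norm_def {N : ℕ} (x : C00 N) :
    ‖x‖ = ⨆ A : {A : Finset ℕ+ // A ∈ family N ∧ A.Nonempty}, ∑ n ∈ A.1, |x.coord n| := rfl

theorem bddAbove_sums {N : ℕ} (x : C00 N) :
    BddAbove (Set.range fun A : {A : Finset ℕ+ // A ∈ family N ∧ A.Nonempty} =>
      ∑ n ∈ A.1, |x.coord n|) := by
  refine ⟨∑ n ∈ (C00.toFinsupp N x).support, |x.coord n|, ?_⟩
  rintro _ ⟨A, rfl⟩
  have hA : ∀ n ∈ A.1, n ∉ A.1 ∩ (C00.toFinsupp N x).support → |x.coord n| = 0 := by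
    intro n hn hn'
    rw [Finset.mem_inter, not_and] at hn'
    exact abs_eq_zero.2 (Finsupp.notMem_support_iff.1 (hn' hn))
  change ∑ n ∈ A.1, |x.coord n| ≤ _
  rw [← Finset.sum_subset Finset.inter_subset_left hA]
  exact Finset.sum_le_sum_of_subset_of_nonneg Finset.inter_subset_right
    fun n _ _ => abs_nonneg _

theorem sum_le_norm {N : ℕ} (x : C00 N) {A : Finset ℕ+} (hA : A ∈ family N) :
    ∑ n ∈ A, |x.coord n| ≤ ‖x‖ := by
  rcases A.eq_empty_or_nonempty with rfl | h
  · rw [Finset.sum_empty]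
    exact Real.iSup_nonneg fun A => Finset.sum_nonneg fun n _ => abs_nonneg _
  · exact le_ciSup (bddAbove_sums x) ⟨A, hA, h⟩

theorem norm_le_of {N : ℕ} (x : C00 N) (c : ℝ)
    (h : ∀ A ∈ family N, ∑ n ∈ A, |x.coord n| ≤ c) : ‖x‖ ≤ c := by
  have : Nonempty {A : Finset ℕ+ // A ∈ family N ∧ A.Nonempty} :=
    ⟨⟨{1}, singleton_mem_family N 1, Finset.singleton_nonempty 1⟩⟩
  exact ciSup_le fun A => h A.1 A.2.1

theorem abs_coord_le_norm {N : ℕ} (x : C00 N) (n : ℕ+) : |x.coord n| ≤ ‖x‖ := by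
  simpa using sum_le_norm x (singleton_mem_family N n)

theorem C00.core (N : ℕ) : NormedSpace.Core ℝ (C00 N) where
  norm_nonneg x := (abs_nonneg _).trans (abs_coord_le_norm x 1)
  norm_smul c x := by
    have h : ∀ n, |(c • x).coord n| = ‖c‖ * |x.coord n| := fun n => abs_mul c (x.coord n)
    simp only [norm_def, h, ← Finset.mul_sum]
    exact (Real.mul_iSup_of_nonneg (norm_nonneg c) _).symm
  norm_triangle x y := by
    refine norm_le_of _ _ fun A hA => ?_
    calc ∑ n ∈ A, |(x + y).coord n| ≤ ∑ n ∈ A, (|x.coord n| + |y.coord n|) :=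
          Finset.sum_le_sum fun n _ => abs_add_le (x.coord n) (y.coord n)
      _ = ∑ n ∈ A, |x.coord n| + ∑ n ∈ A, |y.coord n| := Finset.sum_add_distrib
      _ ≤ ‖x‖ + ‖y‖ := add_le_add (sum_le_norm x hA) (sum_le_norm y hA)
  norm_eq_zero_iff x := by
    constructor
    · intro h
      refine Finsupp.ext fun n => ?_
      exact abs_nonpos_iff.1 (h ▸ abs_coord_le_norm x n)
    · rintro rfl
      refine le_antisymm (norm_le_of _ _ fun A _ => ?_)
        ((abs_nonneg _).trans (abs_coord_le_norm 0 1))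
      exact (Finset.sum_eq_zero fun n _ => abs_zero).le

instance (N : ℕ) : NormedAddCommGroup (C00 N) := NormedAddCommGroup.ofCore (C00.core N)
instance (N : ℕ) : NormedSpace ℝ (C00 N) := NormedSpace.ofCore (C00.core N)

/-- The Schreier space `X[S_N]`, the completion of `c_00` with the Schreier norm. -/
abbrev Space (N : ℕ) : Type := UniformSpace.Completion (C00 N)

/-- The unit vector basis `(ẽ_n)_{n ≥ 1}` of `X[S_N]`. -/
def unitVec (N : ℕ) (n : ℕ+) : Space N :=
  (C00.single N n : UniformSpace.Completion (C00 N))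

/-- The inclusion of `c_00` into `X[S_N]`. -/
def incl (N : ℕ) : C00 N →ₗ[ℝ] Space N :=
  (UniformSpace.Completion.toComplL : C00 N →L[ℝ] UniformSpace.Completion (C00 N)).toLinearMap

theorem norm_incl {N : ℕ} (x : C00 N) : ‖incl N x‖ = ‖x‖ := UniformSpace.Completion.norm_coe x

theorem denseRange_incl (N : ℕ) : DenseRange (incl N) := UniformSpace.Completion.denseRange_coe

theorem incl_single (N : ℕ) (n : ℕ+) :
    incl N (C00.single N n) = unitVec N n := rfl

open Classical in
/-- The restriction of finitely supported sequences to the set `I`. -/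
def restrict (N : ℕ) (I : Set ℕ+) : C00 N →ₗ[ℝ] C00 N where
  toFun x := (C00.toFinsupp N).symm ((C00.toFinsupp N x).filter (fun n => n ∈ I))
  map_add' x y := by rw [map_add, Finsupp.filter_add, map_add]
  map_smul' c x := by rw [map_smul, Finsupp.filter_smul, map_smul, RingHom.id_apply]

/-- The canonical projection `P_I` of `X[S_N]` onto the closed span of the `ẽ_n` with `n ∈ I`: the
continuous extension of the restriction of finitely supported sequences to `I`. -/
def proj (N : ℕ) (I : Set ℕ+) : Space N →L[ℝ] Space N :=
  (incl N ∘ₗ restrict N I).extendOfNorm (incl N)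

/-- The bounded operator on `X[S_N]` which carries each `ẽ_n` to `e_n`: the continuous extension
of `(x_n)_n ↦ ∑ n, x_n e_n` from `c_00`. -/
def opOfSeq (N : ℕ) (e : ℕ+ → Space N) : Space N →L[ℝ] Space N :=
  (Finsupp.linearCombination ℝ e ∘ₗ (C00.toFinsupp N).toLinearMap).extendOfNorm (incl N)

/-- The operator `T_I = T ∘ P_I`, where `T` carries each `ẽ_n` to `e_n`. -/
def opT (N : ℕ) (e : ℕ+ → Space N) (I : Set ℕ+) : Space N →L[ℝ] Space N :=
  (opOfSeq N e).comp (proj N I)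

section

variable {E : Type*} [NormedAddCommGroup E] [NormedSpace ℝ E]

/-- The sequence `e` is equivalent to the unit vector basis of `c_0`: for some `c, C > 0` one has
`c * max |a_n| ≤ ‖∑ n, a_n e_n‖ ≤ C * max |a_n|` for all finitely supported real `(a_n)`. (Such a
sequence is automatically a basic sequence.) -/
def IsEquivToC0Basis (e : ℕ+ → E) : Prop :=
  ∃ c C : ℝ, 0 < c ∧ 0 < C ∧ ∀ a : ℕ+ →₀ ℝ,
    (∀ n, c * |a n| ≤ ‖a.sum fun n t => t • e n‖) ∧
    (∀ M : ℝ, (∀ n, |a n| ≤ M) → ‖a.sum fun n t => t • e n‖ ≤ C * M)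

/-- The sequence `x` dominates the sequence `y`: for some `C` one has
`‖∑ n, a_n y_n‖ ≤ C * ‖∑ n, a_n x_n‖` for all finitely supported real `(a_n)`. -/
def Dominates (x y : ℕ → E) : Prop :=
  ∃ C : ℝ, ∀ a : ℕ →₀ ℝ, ‖a.sum fun n t => t • y n‖ ≤ C * ‖a.sum fun n t => t • x n‖

/-- A (two-sided) operator ideal in the algebra of bounded operators on `E`: a linear subspace that
contains the operators of finite rank and is stable under composition with bounded operators. -/
structure IsOperatorIdeal (K : Submodule ℝ (E →L[ℝ] E)) : Prop where
  finiteRank_mem : ∀ F : E →L[ℝ] E, FiniteDimensional ℝ (LinearMap.range F.toLinearMap) → F ∈ K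
  comp_mem_left : ∀ (A R : E →L[ℝ] E), R ∈ K → A.comp R ∈ K
  comp_mem_right : ∀ (R A : E →L[ℝ] E), R ∈ K → R.comp A ∈ K

/-- The closed operator ideal generated by a family `B` of bounded operators: the smallest operator
ideal that is closed in the operator norm and contains `B`. -/
def closedIdeal (B : Set (E →L[ℝ] E)) : Submodule ℝ (E →L[ℝ] E) :=
  sInf {K | IsOperatorIdeal K ∧ IsClosed (K : Set (E →L[ℝ] E)) ∧ B ⊆ K}

end

/-- The increasing enumeration `i_0 < i_1 < i_2 < …` of an infinite set `I ⊆ {1, 2, 3, …}`. -/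
def enum (I : Set ℕ+) (n : ℕ) : ℕ+ := Nat.toPNat' (Nat.nth (fun m => ∃ i ∈ I, (i : ℕ) = m) n)

/-- The subsequence `(ẽ_i)_{i ∈ I}` of the unit vector basis, for an infinite set `I`. -/
def subseq (N : ℕ) (I : Set ℕ+) (n : ℕ) : Space N := unitVec N (enum I n)

/-! The objects above are the intended ones. -/

theorem enum_strictMono_and_range {I : Set ℕ+} (hI : I.Infinite) :
    StrictMono (enum I) ∧ Set.range (enum I) = I := by
  have hinf : (Set.ofPred fun m : ℕ => ∃ i ∈ I, (i : ℕ) = m).Infinite :=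
    hI.image PNat.coe_injective.injOn
  have key : ∀ n, enum I n ∈ I ∧
      (enum I n : ℕ) = Nat.nth (fun m => ∃ i ∈ I, (i : ℕ) = m) n := by
    intro n
    obtain ⟨i, hi, h⟩ := Nat.nth_mem_of_infinite hinf n
    have : enum I n = i := by rw [enum, ← h, PNat.coe_toPNat']
    exact ⟨this ▸ hi, this ▸ h⟩
  refine ⟨fun a b hab => ?_, ?_⟩
  · rw [← PNat.coe_lt_coe, (key a).2, (key b).2]
    exact Nat.nth_strictMono hinf hab
  · refine Set.Subset.antisymm (Set.range_subset_iff.2 fun n => (key n).1) fun i hi => ?_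
    have : (i : ℕ) ∈ Set.range (Nat.nth fun m => ∃ i ∈ I, (i : ℕ) = m) := by
      rw [Nat.range_nth_of_infinite hinf]
      exact ⟨i, hi, rfl⟩
    obtain ⟨n, hn⟩ := this
    exact ⟨n, PNat.coe_injective ((key n).2.trans hn)⟩

theorem abs_single_coord (N : ℕ) (n m : ℕ+) :
    |(C00.single N n).coord m| = if n = m then 1 else 0 := by
  rw [C00.coord, C00.single, LinearEquiv.apply_symm_apply, Finsupp.single_apply]
  split_ifs <;> simp

theorem norm_unitVec (N : ℕ) (n : ℕ+) : ‖unitVec N n‖ = 1 := by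
  rw [← incl_single, norm_incl]
  refine le_antisymm (norm_le_of _ _ fun A _ => ?_) ?_
  · simp only [abs_single_coord, Finset.sum_ite_eq]
    split_ifs <;> norm_num
  · refine le_trans (le_of_eq ?_) (abs_coord_le_norm _ n)
    rw [abs_single_coord, if_pos rfl]

theorem restrict_coord (N : ℕ) (I : Set ℕ+) [DecidablePred (· ∈ I)] (x : C00 N) (n : ℕ+) :
    (restrict N I x).coord n = if n ∈ I then x.coord n else 0 := by
  simp only [C00.coord, restrict, LinearMap.coe_mk, AddHom.coe_mk, LinearEquiv.apply_symm_apply,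
    Finsupp.filter_apply]
  congr

theorem restrict_single (N : ℕ) (I : Set ℕ+) [DecidablePred (· ∈ I)] (n : ℕ+) :
    restrict N I (C00.single N n) = if n ∈ I then C00.single N n else 0 := by
  simp only [C00.single, restrict, LinearMap.coe_mk, AddHom.coe_mk, LinearEquiv.apply_symm_apply]
  split_ifs with hn
  · exact congrArg _ (by convert Finsupp.filter_single_of_pos (fun n => n ∈ I) hn)
  · refine (congrArg _ ?_).trans (map_zero (C00.toFinsupp N).symm)
    convert Finsupp.filter_single_of_neg (fun n => n ∈ I) hn

theorem norm_restrict_le (N : ℕ) (I : Set ℕ+) (x : C00 N) : ‖restrict N I x‖ ≤ ‖x‖ := by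
  classical
  refine norm_le_of _ _ fun A hA => le_trans (Finset.sum_le_sum fun n _ => ?_) (sum_le_norm x hA)
  rw [restrict_coord]
  split_ifs <;> simp

theorem proj_incl (N : ℕ) (I : Set ℕ+) (x : C00 N) :
    proj N I (incl N x) = incl N (restrict N I x) :=
  LinearMap.extendOfNorm_eq (denseRange_incl N) ⟨1, fun y => by
    rw [LinearMap.comp_apply, norm_incl, norm_incl, one_mul]
    exact norm_restrict_le N I y⟩ x

theorem opOfSeq_unitVec {N : ℕ} {e : ℕ+ → Space N} (he : IsEquivToC0Basis e) (n : ℕ+) :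
    opOfSeq N e (unitVec N n) = e n := by
  obtain ⟨c, C, -, -, h⟩ := he
  rw [← incl_single, opOfSeq, LinearMap.extendOfNorm_eq (denseRange_incl N) ⟨C, fun y => ?_⟩]
  · simp [C00.single]
  · rw [norm_incl]
    exact (h (C00.toFinsupp N y)).2 ‖y‖ (abs_coord_le_norm y)

theorem opT_unitVec {N : ℕ} {e : ℕ+ → Space N} (he : IsEquivToC0Basis e) (I : Set ℕ+)
    [DecidablePred (· ∈ I)] (n : ℕ+) :
    opT N e I (unitVec N n) = if n ∈ I then e n else 0 := by
  have h : proj N I (unitVec N n) = if n ∈ I then unitVec N n else 0 := by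
    rw [← incl_single, proj_incl, restrict_single]
    split_ifs
    · rfl
    · exact map_zero _
  rw [opT, ContinuousLinearMap.comp_apply, h]
  split_ifs
  · exact opOfSeq_unitVec he n
  · exact map_zero _

end Schreier

end

/-!
Suppose that `‖T_I - Q‖ < 1`. As `T_I` carries `ẽ_i` to a unit vector for `i ∈ I`, the norms
`‖Q ẽ_i‖` are then bounded below. The operators whose values are controlled, up to small errors, by
finitely many functionals and by the coordinates of finitely many images `β x` with indices in
finitely many sets `J ∈ 𝒥`, form a closed operator ideal that contains all `T_J`
(`closedIdeal_le_controlled`), because `(e_n)` behaves like the basis of `c_0`. So `Q` is one of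
them. As `(ẽ_n)` is weakly null (`finite_lt_abs_apply_unitVec`), for almost all `i ∈ I` one of
finitely many operators `β` has a large matrix entry at `(j, i)` for some `j = j(i)` in the union `J`
of finitely many members of `𝒥`. Choosing signs at random one removes the other entries of `β`
(`good_of_le_abs_coordL`), and `ẽ_i ↦ ẽ_{j(i)}` induces a bounded map (`IsBoundedMap`) from
`(ẽ_i)_{i ∈ I}` to `(ẽ_j)_{j ∈ J}`. The map `i ↦ j(i)` has no reason to respect the order or to be
injective, while domination compares the increasing enumerations of `I` and `J`. Passing from the
former to the latter is the combinatorial heart of the matter, `IsBoundedMap.exists_good`.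

It is an induction on `N` which uses two facts. Boundedness for `S_{N+1}` implies boundedness for
`S_N` (`IsBoundedMap.of_succ`): averages that are sufficiently small for `S_N` are equivalent to the
basis of `c_0` for `S_{N+1}`, while their images, being supported by successive sets in `S_N`, would
be equivalent to the basis of `ℓ_1`. For `S_0` boundedness says that the fibres of `i ↦ j(i)` have at
most `M` elements. Moreover, `S_{N+1} = S_N[S_1]` (`Adm.of_blocks`, `Adm.exists_blocks`), that is,
sets in `S_{N+1}` consist of successive pieces, the piece starting at `p` having size at most `p`,
such that the starting points form a set in `S_N`. At most `M * p` indices are mapped to places before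
the `p`-th one. These form `M` blocks that are again of admissible size, so the induction hypothesis
for the starting points deals with them. The images of the other indices are so far to the right
that they form a set in `S_{N+1}`, and boundedness applies to them.

All this is done with positions in the enumerations: `n : ℕ` stands for the `n`-th element of `I` or
of `J`, whose value is the `n`-th term of a sequence `w` or `v`.
-/

namespace Schreier

section

open Finset

/-! ### Schreier families along a sequence -/

/-- The Schreier family `S_N` transported to `ℕ` along an enumeration whose `n`-th term is `w n`: a
finite set `A` of indices is admissible if `{w n : n ∈ A}` lies in `S_N`. The successive pieces of
`A` are the fibres of the monotone map `b` with values in `{0, …, k - 1}`, some of which may be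
empty. -/
def Adm (w : ℕ → ℕ) : ℕ → Finset ℕ → Prop
  | 0, A => #A ≤ 1
  | N + 1, A => ∃ (k : ℕ) (b : ℕ → ℕ), (∀ n ∈ A, b n < k) ∧ (∀ n ∈ A, k ≤ w n) ∧
      MonotoneOn b A ∧ ∀ t, Adm w N {n ∈ A | b n = t}

/-- The Schreier families are spreading and hereditary. -/
theorem Adm.spread {w : ℕ → ℕ} (hw : Monotone w) {N : ℕ} {U V : Finset ℕ} {θ : ℕ → ℕ}
    (hV : Adm w N V) (hθ : StrictMonoOn θ U) (hm : ∀ u ∈ U, θ u ∈ V) (hle : ∀ u ∈ U, θ u ≤ u) :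
    Adm w N U := by
  induction N generalizing U V with
  | zero => exact (card_le_card_of_injOn θ hm hθ.injOn).trans hV
  | succ N ih =>
    obtain ⟨k, b, h1, h2, h3, h4⟩ := hV
    refine ⟨k, b ∘ θ, fun n hn => h1 _ (hm n hn), fun n hn => (h2 _ (hm n hn)).trans
      (hw (hle n hn)), fun x hx y hy hxy => h3 (hm x hx) (hm y hy) (hθ.monotoneOn hx hy hxy),
      fun t => ih (h4 t) (hθ.mono ?_) ?_ ?_⟩
    · exact coe_subset.2 (filter_subset _ _)
    · intro u hu
      rw [mem_filter] at hu ⊢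
      exact ⟨hm u hu.1, hu.2⟩
    · exact fun u hu => hle u (mem_filter.1 hu).1

/-- Unlike `Adm.spread`, this needs no monotonicity of `w`. -/
theorem Adm.subset {w : ℕ → ℕ} {N : ℕ} {U V : Finset ℕ}
    (hV : Adm w N V) (h : U ⊆ V) : Adm w N U := by
  induction N generalizing U V with
  | zero => exact (card_le_card h).trans hV
  | succ N ih =>
    obtain ⟨k, b, h1, h2, h3, h4⟩ := hV
    exact ⟨k, b, fun n hn => h1 n (h hn), fun n hn => h2 n (h hn), h3.mono (coe_subset.2 h),
      fun t => ih (h4 t) (filter_subset_filter _ h)⟩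

theorem Adm.of_card_le_one {w : ℕ → ℕ} (hw : ∀ n, 1 ≤ w n) (N : ℕ) {A : Finset ℕ}
    (hA : #A ≤ 1) : Adm w N A := by
  induction N generalizing A with
  | zero => exact hA
  | succ N ih =>
    exact ⟨1, fun _ => 0, fun _ _ => one_pos, fun n _ => hw n, monotoneOn_const,
      fun t => ih ((card_le_card (filter_subset _ _)).trans hA)⟩

/-- If every initial segment of `ℕ` contains at least as many points of `V` as of `U`, then `U`
embeds monotonically into `V` by a map that moves no point to the right. -/
theorem exists_strictMonoOn_of_count_le {U V : Finset ℕ}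
    (h : ∀ y, #{u ∈ U | u < y} ≤ #{v ∈ V | v < y}) :
    ∃ θ : ℕ → ℕ, StrictMonoOn θ U ∧ (∀ u ∈ U, θ u ∈ V) ∧ ∀ u ∈ U, θ u ≤ u := by
  have hc : ∀ (W : Finset ℕ) y, Nat.count (· ∈ W) y = #{u ∈ W | u < y} := by
    intro W y
    rw [Nat.count_eq_card_filter_range]
    congr 1
    ext a
    simp [and_comm]
  have hlt : ∀ u ∈ U, Nat.count (· ∈ U) u < Nat.count (· ∈ V) (u + 1) := by
    intro u hu
    refine lt_of_lt_of_le ?_ ((hc U (u + 1)).le.trans ((h (u + 1)).trans (hc V (u + 1)).ge))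
    rw [Nat.count_succ, if_pos hu]
    exact Nat.lt_succ_self _
  have hcard : ∀ u ∈ U, ∀ hf : (Set.ofPred (· ∈ V)).Finite,
      Nat.count (· ∈ U) u < #hf.toFinset := by
    intro u hu hf
    refine (hlt u hu).trans_le ?_
    rw [hc]
    refine card_le_card fun v hv => ?_
    rw [Set.Finite.mem_toFinset]
    exact (mem_filter.1 hv).1
  refine ⟨fun u => Nat.nth (· ∈ V) (Nat.count (· ∈ U) u), ?_, ?_, ?_⟩
  · intro u hu v hv huv
    exact Nat.nth_lt_nth' (Nat.count_strict_mono hu huv) (hcard v hv)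
  · intro u hu
    exact Nat.nth_mem _ (hcard u hu)
  · intro u hu
    exact Nat.lt_succ_iff.1 (Nat.nth_lt_of_lt_count (hlt u hu))

theorem rank_strictMonoOn (S : Finset ℕ) : StrictMonoOn (fun x => #{y ∈ S | y < x}) S := by
  intro x hx y hy hxy
  refine card_lt_card ⟨fun z hz => ?_, fun hs => ?_⟩
  · rw [mem_filter] at hz ⊢
    exact ⟨hz.1, hz.2.trans hxy⟩
  · have := hs (mem_filter.2 ⟨hx, hxy⟩)
    exact lt_irrefl _ (mem_filter.1 this).2

theorem rank_lt_card {S : Finset ℕ} {x : ℕ} (hx : x ∈ S) : #{y ∈ S | y < x} < #S :=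
  card_lt_card ⟨filter_subset _ _, fun hs => lt_irrefl _ (mem_filter.1 (hs hx)).2⟩

/-- The ranks of the points of `S` are `0, …, #S - 1`. -/
theorem le_card_rank_lt (S : Finset ℕ) (m : ℕ) :
    min #S m ≤ #{x ∈ S | #{y ∈ S | y < x} < m} := by
  have him : S.image (fun x => #{y ∈ S | y < x}) = range #S := by
    refine eq_of_subset_of_card_le (fun r hr => ?_) ?_
    · obtain ⟨x, hx, rfl⟩ := mem_image.1 hr
      exact mem_range.2 (rank_lt_card hx)
    · rw [card_range, card_image_of_injOn (rank_strictMonoOn S).injOn]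
  calc min #S m = #(range (min #S m)) := (card_range _).symm
    _ ≤ #({x ∈ S | #{y ∈ S | y < x} < m}.image fun x => #{y ∈ S | y < x}) := by
        refine card_le_card fun r hr => ?_
        rw [mem_range, lt_min_iff] at hr
        obtain ⟨x, hx, rfl⟩ := mem_image.1 (him.ge (mem_range.2 hr.1))
        exact mem_image.2 ⟨x, mem_filter.2 ⟨hx, hr.2⟩, rfl⟩
    _ ≤ _ := card_image_le

/-- `S_N[S_1] ⊆ S_{N+1}`: a union of successive blocks, one for each point `p` of a set in `S_N`,
the block of `p` being to the right of `p` and of size at most `w p`. -/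
theorem Adm.of_blocks {w : ℕ → ℕ} (hw : Monotone w) {N : ℕ} {G W : Finset ℕ} {c : ℕ → ℕ}
    (hG : Adm w N G) (hc : MonotoneOn c W) (hm : ∀ x ∈ W, c x ∈ G) (hle : ∀ x ∈ W, c x ≤ x)
    (hcard : ∀ p ∈ G, #{x ∈ W | c x = p} ≤ w p) : Adm w (N + 1) W := by
  induction N generalizing G W with
  | zero =>
    refine ⟨#W, fun x => #{y ∈ W | y < x}, fun n hn => rank_lt_card hn, fun n hn => ?_,
      (rank_strictMonoOn W).monotoneOn, fun t => ?_⟩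
    · refine le_trans ?_ ((hcard (c n) (hm n hn)).trans (hw (hle n hn)))
      refine card_le_card fun x hx => mem_filter.2 ⟨hx, ?_⟩
      exact card_le_one.1 hG _ (hm x hx) _ (hm n hn)
    · refine card_le_one.2 fun x hx y hy => ?_
      rw [mem_filter] at hx hy
      exact (rank_strictMonoOn W).injOn hx.1 hy.1 (hx.2.trans hy.2.symm)
  | succ N ih =>
    obtain ⟨k, b, h1, h2, h3, h4⟩ := hG
    refine ⟨k, b ∘ c, fun n hn => h1 _ (hm n hn), fun n hn => (h2 _ (hm n hn)).trans
      (hw (hle n hn)), fun x hx y hy hxy => h3 (hm x hx) (hm y hy) (hc hx hy hxy),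
      fun t => ih (h4 t) (hc.mono ?_) ?_ ?_ ?_⟩
    · exact coe_subset.2 (filter_subset _ _)
    · intro u hu
      rw [mem_filter] at hu ⊢
      exact ⟨hm u hu.1, hu.2⟩
    · exact fun u hu => hle u (mem_filter.1 hu).1
    · intro p hp
      exact (card_le_card (filter_subset_filter _ (filter_subset _ _))).trans
        (hcard p (mem_filter.1 hp).1)

/-- `S_{N+1} ⊆ S_N[S_1]`: every set in `S_{N+1}` is cut into successive pieces, the fibres of `c`,
such that the first points `p` of the pieces form a set in `S_N` and the piece of `p` has at most
`w p` elements. -/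
theorem Adm.exists_blocks {w : ℕ → ℕ} {N : ℕ} {A : Finset ℕ}
    (hA : Adm w (N + 1) A) :
    ∃ c : ℕ → ℕ, MonotoneOn c A ∧ (∀ x ∈ A, c x ∈ A) ∧ (∀ x ∈ A, c x ≤ x) ∧
      (∀ x ∈ A, c (c x) = c x) ∧ Adm w N (A.image c) ∧ ∀ p ∈ A, #{x ∈ A | c x = p} ≤ w p := by
  induction N generalizing A with
  | zero =>
    obtain ⟨k, b, h1, h2, h3, h4⟩ := hA
    rcases A.eq_empty_or_nonempty with rfl | hne
    · exact ⟨id, by simp [Adm, MonotoneOn]⟩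
    refine ⟨fun _ => A.min' hne, monotoneOn_const, fun _ _ => min'_mem _ _,
      fun x hx => min'_le _ _ hx, fun _ _ => rfl, ?_, fun p hp => ?_⟩
    · exact card_le_one.2 fun x hx y hy => by
        obtain ⟨_, _, rfl⟩ := mem_image.1 hx
        obtain ⟨_, _, rfl⟩ := mem_image.1 hy
        rfl
    · refine le_trans ?_ (h2 p hp)
      refine (card_le_card (filter_subset _ _)).trans ?_
      refine (card_le_card_of_injOn b (t := range k) (fun n hn => ?_) ?_).trans (card_range k).le
      · exact mem_coe.2 (mem_range.2 (h1 n hn))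
      · intro x hx y hy hxy
        exact card_le_one.1 (h4 (b y)) x (mem_filter.2 ⟨hx, hxy⟩) y (mem_filter.2 ⟨hy, rfl⟩)
  | succ N ih =>
    obtain ⟨k, b, h1, h2, h3, h4⟩ := hA
    choose c c1 c2 c3 c4 c5 c6 using fun t => ih (h4 t)
    have hmem : ∀ x ∈ A, x ∈ A.filter (b · = b x) := fun x hx => mem_filter.2 ⟨hx, rfl⟩
    have hcA : ∀ x ∈ A, c (b x) x ∈ A := fun x hx => (mem_filter.1 (c2 _ x (hmem x hx))).1
    have hbc : ∀ x ∈ A, b (c (b x) x) = b x := fun x hx => (mem_filter.1 (c2 _ x (hmem x hx))).2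
    refine ⟨fun x => c (b x) x, ?_, hcA, fun x hx => c3 _ x (hmem x hx), ?_, ?_, ?_⟩
    · intro x hx y hy hxy
      rcases (h3 hx hy hxy).eq_or_lt with h | h
      · have := c1 (b y) (mem_filter.2 ⟨hx, h⟩) (hmem y hy) hxy
        simpa only [h] using this
      · by_contra hlt
        have := h3 (hcA y hy) (hcA x hx) (not_le.1 hlt).le
        rw [hbc x hx, hbc y hy] at this
        omega
    · intro x hx
      simp only [hbc x hx]
      exact c4 _ x (hmem x hx)
    · refine ⟨k, b, ?_, ?_, h3.mono ?_, fun t => (c5 t).subset ?_⟩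
      · intro n hn
        obtain ⟨x, hx, rfl⟩ := mem_image.1 hn
        exact h1 _ (hcA x hx)
      · intro n hn
        obtain ⟨x, hx, rfl⟩ := mem_image.1 hn
        exact h2 _ (hcA x hx)
      · intro n hn
        obtain ⟨x, hx, rfl⟩ := mem_image.1 (mem_coe.1 hn)
        exact hcA x hx
      · intro n hn
        obtain ⟨hn', rfl⟩ := mem_filter.1 hn
        obtain ⟨x, hx, rfl⟩ := mem_image.1 hn'
        rw [hbc x hx]
        exact mem_image.2 ⟨x, hmem x hx, rfl⟩
    · intro p hp
      refine le_trans (card_le_card fun x hx => ?_) (c6 (b p) p (hmem p hp))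
      obtain ⟨hx', rfl⟩ := mem_filter.1 hx
      rw [hbc x hx']
      exact mem_filter.2 ⟨hmem x hx', rfl⟩

/-! ### Sets on which the Schreier norm is equivalent to the `ℓ_1`-norm -/

/-- On `A` the `ℓ_1`-norm is at most `K` times the Schreier norm along `w`. -/
def Good (w : ℕ → ℕ) (N : ℕ) (K : ℝ) (A : Finset ℕ) : Prop :=
  ∀ a : ℕ → ℝ, (∀ n, 0 ≤ a n) → ∃ G ⊆ A, Adm w N G ∧ ∑ n ∈ A, a n ≤ K * ∑ n ∈ G, a n

theorem Good.union {w : ℕ → ℕ} {N : ℕ} {K L : ℝ} {A B : Finset ℕ} (hK : 0 ≤ K) (hL : 0 ≤ L)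
    (hA : Good w N K A) (hB : Good w N L B) : Good w N (K + L) (A ∪ B) := by
  intro a ha
  obtain ⟨G, hG, hG1, hG2⟩ := hA a ha
  obtain ⟨F, hF, hF1, hF2⟩ := hB a ha
  have hs : ∑ n ∈ A ∪ B, a n ≤ ∑ n ∈ A, a n + ∑ n ∈ B, a n := by
    rw [← sum_union_inter]
    exact le_add_of_nonneg_right (sum_nonneg fun n _ => ha n)
  rcases le_total (∑ n ∈ G, a n) (∑ n ∈ F, a n) with h | h
  · exact ⟨F, hF.trans subset_union_right, hF1, by nlinarith [mul_le_mul_of_nonneg_left h hK]⟩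
  · exact ⟨G, hG.trans subset_union_left, hG1, by nlinarith [mul_le_mul_of_nonneg_left h hL]⟩

theorem Good.spread {w : ℕ → ℕ} (hw : Monotone w) {N : ℕ} {K : ℝ} {U V : Finset ℕ} {θ : ℕ → ℕ}
    (hV : Good w N K V) (hθ : StrictMonoOn θ U) (hm : ∀ u ∈ U, θ u ∈ V)
    (hle : ∀ u ∈ U, θ u ≤ u) : Good w N K U := by
  intro a ha
  obtain ⟨G, hG, hG1, hG2⟩ := hV (fun v => ∑ u ∈ U with θ u = v, a u)
    fun v => sum_nonneg fun n _ => ha n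
  refine ⟨{u ∈ U | θ u ∈ G}, filter_subset _ _, hG1.spread hw (hθ.mono ?_) ?_ ?_, ?_⟩
  · exact coe_subset.2 (filter_subset _ _)
  · exact fun u hu => (mem_filter.1 hu).2
  · exact fun u hu => hle u (mem_filter.1 hu).1
  · rw [sum_fiberwise_of_maps_to hm] at hG2
    refine hG2.trans_eq ?_
    rw [← sum_fiberwise_of_maps_to (s := {u ∈ U | θ u ∈ G}) (t := G) (g := θ)
      fun u hu => (mem_filter.1 hu).2]
    congr 1
    refine sum_congr rfl fun v hv => sum_congr ?_ fun _ _ => rfl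
    ext u
    simp only [mem_filter]
    constructor
    · rintro ⟨h1, rfl⟩
      exact ⟨⟨h1, hv⟩, rfl⟩
    · rintro ⟨⟨h1, _⟩, h2⟩
      exact ⟨h1, h2⟩

theorem Good.of_card_le {w : ℕ → ℕ} (hw : ∀ n, 1 ≤ w n) (N : ℕ) {A : Finset ℕ} {m : ℕ}
    (hA : #A ≤ m) : Good w N m A := by
  intro a ha
  rcases A.eq_empty_or_nonempty with rfl | hne
  · exact ⟨∅, subset_rfl, Adm.of_card_le_one hw N (by simp), by simp⟩
  obtain ⟨x, hx, hmax⟩ := exists_max_image A a hne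
  refine ⟨{x}, singleton_subset_iff.2 hx, Adm.of_card_le_one hw N (by simp), ?_⟩
  rw [sum_singleton]
  refine (sum_le_card_nsmul A a (a x) hmax).trans ?_
  rw [nsmul_eq_mul]
  exact mul_le_mul_of_nonneg_right (by exact_mod_cast hA) (ha x)

theorem Good.subset {w : ℕ → ℕ} (hw : Monotone w) {N : ℕ} {K : ℝ} {A B : Finset ℕ}
    (hB : Good w N K B) (h : A ⊆ B) : Good w N K A :=
  hB.spread hw (θ := id) strictMonoOn_id h fun _ _ => le_rfl

theorem Good.biUnion {ι : Type*} {w : ℕ → ℕ} (hw : ∀ n, 1 ≤ w n) {N : ℕ} (s : Finset ι)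
    {K : ι → ℝ} {B : ι → Finset ℕ} (hK : ∀ t, 0 ≤ K t) (h : ∀ t ∈ s, Good w N (K t) (B t)) :
    Good w N (∑ t ∈ s, K t) (s.biUnion B) := by
  classical
  induction s using Finset.induction_on with
  | empty => simpa using Good.of_card_le hw N (A := ∅) (m := 0) (by simp)
  | insert t s ht ih =>
    rw [sum_insert ht, biUnion_insert]
    exact (h t (mem_insert_self _ _)).union (hK t) (sum_nonneg fun t _ => hK t)
      (ih fun t ht => h t (mem_insert_of_mem ht))

/-- Among `M * k` nonnegative numbers, some `k` carry the `M`-th part of the sum. -/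
theorem exists_subset_sum_le {a : ℕ → ℝ} (ha : ∀ n, 0 ≤ a n) (k M : ℕ) {S : Finset ℕ}
    (hS : #S ≤ M * k) : ∃ T ⊆ S, #T ≤ k ∧ ∑ n ∈ S, a n ≤ M * ∑ n ∈ T, a n := by
  induction M generalizing S with
  | zero =>
    have : S = ∅ := by simpa using hS
    exact ⟨∅, empty_subset _, by simp, by simp [this]⟩
  | succ M ih =>
    rcases le_total #S k with h | h
    · refine ⟨S, subset_rfl, h, le_mul_of_one_le_left (sum_nonneg fun n _ => ha n) ?_⟩
      push_cast
      linarith [(Nat.cast_nonneg M : (0 : ℝ) ≤ M)]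
    obtain ⟨T, hT, hTc⟩ := exists_subset_card_eq h
    obtain ⟨T', hT', hTc', hs⟩ := ih (S := S \ T) (by
      rw [card_sdiff_of_subset hT, hTc]
      rw [Nat.succ_mul] at hS
      omega)
    have hsum := sum_sdiff (f := a) hT
    have hM : (0 : ℝ) ≤ M := Nat.cast_nonneg M
    rcases le_total (∑ n ∈ T, a n) (∑ n ∈ T', a n) with h' | h'
    · exact ⟨T', hT'.trans sdiff_subset, hTc', by push_cast; nlinarith⟩
    · exact ⟨T, hT, hTc.le, by push_cast; nlinarith [mul_le_mul_of_nonneg_left h' hM]⟩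

/-! ### Averages of small norm -/

/-- The Schreier norm along `w` of the nonnegative sequence `a` is at most `c`. -/
def NormLE (w : ℕ → ℕ) (N : ℕ) (a : ℕ → ℝ) (c : ℝ) : Prop :=
  ∀ G, Adm w N G → ∑ n ∈ G, a n ≤ c

/-- `a` is a convex combination, with coefficients supported by `B`, whose Schreier norm along `w`
is at most `ε`. -/
structure IsSmallAverage (w : ℕ → ℕ) (N : ℕ) (ε : ℝ) (B : Finset ℕ) (a : ℕ → ℝ) : Prop where
  nonneg : ∀ n, 0 ≤ a n
  eq_zero : ∀ n, n ∉ B → a n = 0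
  sum_eq : ∑ n ∈ B, a n = 1
  normLE : NormLE w N a ε

theorem sum_le_sum_of_eq_zero {a : ℕ → ℝ} (ha : ∀ n, 0 ≤ a n) {B : Finset ℕ}
    (hB : ∀ n, n ∉ B → a n = 0) (G : Finset ℕ) : ∑ n ∈ G, a n ≤ ∑ n ∈ B, a n := by
  rw [← sum_subset (inter_subset_left : G ∩ B ⊆ G)
    fun n hn hn' => hB n fun h => hn' (mem_inter.2 ⟨hn, h⟩)]
  exact sum_le_sum_of_subset_of_nonneg inter_subset_right fun n _ _ => ha n

theorem sum_union_add {x a : ℕ → ℝ} {X B : Finset ℕ} (hX : ∀ n, n ∉ X → x n = 0)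
    (hB : ∀ n, n ∉ B → a n = 0) :
    ∑ n ∈ X ∪ B, (x n + a n) = ∑ n ∈ X, x n + ∑ n ∈ B, a n := by
  rw [sum_add_distrib, ← sum_subset (subset_union_left : X ⊆ X ∪ B) fun n _ h => hX n h,
    ← sum_subset (subset_union_right : B ⊆ X ∪ B) fun n _ h => hB n h]

/-- An average that is small enough in the norm of `S_N`, depending on the support of `x`, is
almost disjoint from `x` in the norm of `S_{N+1}`: a set in `S_{N+1}` that meets the support `X` of
`x` consists of at most `max_X w` sets in `S_N`. -/
theorem exists_normLE_add {w : ℕ → ℕ} {N : ℕ} {x : ℕ → ℝ} {X : Finset ℕ} {c δ : ℝ}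
    (hX : ∀ n, n ∉ X → x n = 0) (hc : 1 ≤ c) (hx : NormLE w (N + 1) x c) (hδ : 0 < δ) :
    ∃ ε > 0, ∀ B a, IsSmallAverage w N ε B a →
      NormLE w (N + 1) (fun n => x n + a n) (c + δ) := by
  have hW : (0 : ℝ) < X.sup w + 1 := by positivity
  refine ⟨δ / (X.sup w + 1), div_pos hδ hW, fun B a ha G hG => ?_⟩
  rw [sum_add_distrib]
  by_cases h : ∃ n ∈ G, n ∈ X
  · obtain ⟨n, hnG, hnX⟩ := h
    refine add_le_add (hx G hG) ?_
    obtain ⟨k, b, h1, h2, h3, h4⟩ := hG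
    have hk : (k : ℝ) ≤ X.sup w + 1 := by
      have : k ≤ X.sup w := (h2 n hnG).trans (le_sup (f := w) hnX)
      have : (k : ℝ) ≤ X.sup w := by exact_mod_cast this
      linarith
    rw [← sum_fiberwise_of_maps_to (t := range k) (g := b) fun m hm => mem_range.2 (h1 m hm)]
    refine (sum_le_card_nsmul _ _ _ fun t _ => ha.normLE _ (h4 t)).trans ?_
    rw [card_range, nsmul_eq_mul, mul_div_assoc', div_le_iff₀ hW]
    nlinarith
  · have h0 : ∑ n ∈ G, x n = 0 :=
      sum_eq_zero fun n hn => hX n fun hn' => h ⟨n, hn, hn'⟩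
    have h1 := (sum_le_sum_of_eq_zero ha.nonneg ha.eq_zero G).trans_eq ha.sum_eq
    linarith

theorem normLE_zero (w : ℕ → ℕ) (N : ℕ) {c : ℝ} (hc : 1 < c) :
    NormLE w N (fun _ => 0) c := fun G _ => by
  rw [sum_const_zero]
  linarith

/-- No subsequence of the unit vector basis is equivalent to the basis of `ℓ_1`. -/
theorem exists_isSmallAverage (w : ℕ → ℕ) (N : ℕ) {L : Set ℕ} (hL : L.Infinite) {ε : ℝ}
    (hε : 0 < ε) : ∃ (B : Finset ℕ) (a : ℕ → ℝ), (B : Set ℕ) ⊆ L ∧ IsSmallAverage w N ε B a := by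
  induction N generalizing ε with
  | zero =>
    obtain ⟨m, hm⟩ := exists_nat_gt (1 / ε)
    have hm0 : (0 : ℝ) < m := (one_div_pos.2 hε).trans hm
    obtain ⟨B, hB, hc⟩ := hL.exists_subset_card_eq m
    refine ⟨B, fun n => if n ∈ B then 1 / m else 0, hB, fun n => ?_, fun n hn => if_neg hn, ?_,
      fun G hG => ?_⟩
    · split_ifs <;> positivity
    · rw [sum_congr rfl fun n hn => if_pos hn, sum_const, hc, nsmul_eq_mul]
      field_simp
    · have h1 : 1 / (m : ℝ) ≤ ε := (one_div_lt hε hm0).1 hm |>.le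
      refine (sum_le_card_nsmul G _ ε fun n _ => ?_).trans ?_
      · split_ifs
        exacts [h1, hε.le]
      · rw [nsmul_eq_mul]
        have : (#G : ℝ) ≤ 1 := by exact_mod_cast (show #G ≤ 1 from hG)
        nlinarith
  | succ N ih =>
    have key : ∀ r : ℕ, ∀ c : ℝ, 1 < c → ∃ (B : Finset ℕ) (x : ℕ → ℝ),
        (B : Set ℕ) ⊆ L ∧ (∀ n, 0 ≤ x n) ∧ (∀ n, n ∉ B → x n = 0) ∧ ∑ n ∈ B, x n = r ∧
        NormLE w (N + 1) x c := by
      intro r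
      induction r with
      | zero =>
        exact fun c hc => ⟨∅, fun _ => 0, by simp, fun _ => le_rfl, fun _ _ => rfl, by simp,
          normLE_zero w _ hc⟩
      | succ r ihr =>
        intro c hc
        obtain ⟨X, x, x1, x2, x3, x4, x5⟩ := ihr ((1 + c) / 2) (by linarith)
        obtain ⟨ε', hε', h⟩ := exists_normLE_add x3 (by linarith) x5
          (show 0 < (c - 1) / 2 by linarith)
        obtain ⟨B, a, ha1, ha⟩ := ih hε'
        refine ⟨X ∪ B, fun n => x n + a n, ?_, fun n => add_nonneg (x2 n) (ha.nonneg n), ?_, ?_, ?_⟩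
        · rw [coe_union]
          exact Set.union_subset x1 ha1
        · intro n hn
          rw [notMem_union] at hn
          simp only [x3 n hn.1, ha.eq_zero n hn.2, add_zero]
        · rw [sum_union_add x3 ha.eq_zero, x4, ha.sum_eq]
          push_cast
          rfl
        · convert h B a ha using 1
          ring
    obtain ⟨r, hr⟩ := exists_nat_gt (2 / ε)
    have hr0 : (0 : ℝ) < r := (div_pos two_pos hε).trans hr
    obtain ⟨B, x, x1, x2, x3, x4, x5⟩ := key r 2 one_lt_two
    refine ⟨B, fun n => x n / r, x1, fun n => div_nonneg (x2 n) hr0.le, fun n hn => ?_, ?_,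
      fun G hG => ?_⟩
    · rw [x3 n hn, zero_div]
    · rw [← sum_div, x4, div_self hr0.ne']
    · rw [← sum_div, div_le_iff₀ hr0]
      rw [div_lt_iff₀ hε] at hr
      linarith [x5 G hG]

/-! ### Maps of indices that induce bounded maps -/

/-- The map carrying the `n`-th vector of the sequence along `w` to the `ψ n`-th vector of the
sequence along `v` is bounded, for the norms of `S_N`, on vectors with nonnegative coefficients. For
such vectors this amounts to the stated condition: sets that `ψ` carries to sets in `S_N` are good,
with a common constant. -/
def IsBoundedMap (w v : ℕ → ℕ) (ψ : ℕ → ℕ) (N : ℕ) : Prop :=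
  ∃ K : ℝ, 0 ≤ K ∧ ∀ B : Finset ℕ, Adm v N (B.image ψ) → Good w N K B

/-- On a fibre of `ψ`, boundedness would make the norm equivalent to that of `ℓ_1`. -/
theorem IsBoundedMap.finite_fiber {w v ψ : ℕ → ℕ} {N : ℕ} (hv : ∀ n, 1 ≤ v n)
    (h : IsBoundedMap w v ψ N) (u : ℕ) : {n | ψ n = u}.Finite := by
  by_contra hinf
  obtain ⟨K, hK, h⟩ := h
  obtain ⟨B, a, hB, ha⟩ := exists_isSmallAverage w N hinf (show 0 < 1 / (K + 1) by positivity)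
  obtain ⟨G, -, hG, hle⟩ := h B (Adm.of_card_le_one hv N (card_le_one.2 fun x hx y hy => by
    obtain ⟨x, hx', rfl⟩ := mem_image.1 hx
    obtain ⟨y, hy', rfl⟩ := mem_image.1 hy
    exact (hB hx').trans (hB hy').symm)) a ha.nonneg
  rw [ha.sum_eq] at hle
  have := hle.trans (mul_le_mul_of_nonneg_left (ha.normLE G hG) hK)
  rw [mul_one_div, le_div_iff₀ (by positivity)] at this
  linarith

/-- The averages witnessing that a map is not bounded can be chosen with images arbitrarily far to
the right, as they give little weight to the finitely many other indices. -/
theorem exists_isSmallAverage_of_not_isBoundedMap {w v ψ : ℕ → ℕ} {N : ℕ} (hw : ∀ n, 1 ≤ w n)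
    (hψ : ∀ u, {n | ψ n = u}.Finite) (h : ¬ IsBoundedMap w v ψ N) (R : ℕ) {ε : ℝ} (hε : 0 < ε) :
    ∃ B a, IsSmallAverage w N ε B a ∧ Adm v N (B.image ψ) ∧ ∀ n ∈ B, R ≤ ψ n := by
  have hfin : {n | ψ n < R}.Finite := by
    refine ((Set.finite_Iio R).biUnion fun u _ => hψ u).subset fun n hn => ?_
    exact Set.mem_biUnion (show ψ n ∈ Set.Iio R from hn) rfl
  set F := hfin.toFinset
  set K : ℝ := 2 / ε + 2 * #F with hK
  have hK0 : 0 < K := by positivity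
  have : ∃ B : Finset ℕ, Adm v N (B.image ψ) ∧ ¬ Good w N K B := by
    by_contra hcon
    push Not at hcon
    exact h ⟨K, hK0.le, hcon⟩
  obtain ⟨B, hB, hG⟩ := this
  unfold Good at hG
  push Not at hG
  obtain ⟨a, ha, hG⟩ := hG
  set s := ∑ n ∈ B, a n with hs
  set B' := {n ∈ B | R ≤ ψ n} with hB'
  have hs0 : 0 < s := by
    simpa using hG ∅ (empty_subset _) (Adm.of_card_le_one hw N (by simp))
  -- The finitely many `n` with `ψ n < R` carry at most half of the sum.
  have hsmall : ∑ n ∈ B with ¬ R ≤ ψ n, a n ≤ s / 2 := by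
    refine (sum_le_card_nsmul _ _ (s / K) fun n hn => ?_).trans ?_
    · have := hG {n} (singleton_subset_iff.2 (mem_filter.1 hn).1)
        (Adm.of_card_le_one hw N (by simp))
      rw [sum_singleton] at this
      rw [le_div_iff₀ hK0]
      linarith
    · have hc : #{n ∈ B | ¬ R ≤ ψ n} ≤ #F := card_le_card fun n hn => by
        rw [Set.Finite.mem_toFinset]
        exact not_le.1 (mem_filter.1 hn).2
      have hc' : (#{n ∈ B | ¬ R ≤ ψ n} : ℝ) ≤ #F := by exact_mod_cast hc
      have h2 : 0 < 2 / ε := by positivity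
      rw [nsmul_eq_mul, mul_div_assoc', div_le_iff₀ hK0, hK]
      nlinarith
  have hs' : s / 2 ≤ ∑ n ∈ B', a n := by
    have := sum_filter_add_sum_filter_not B (fun n => R ≤ ψ n) a
    linarith
  have hs0' : 0 < ∑ n ∈ B', a n := by linarith
  refine ⟨B', fun n => if n ∈ B' then a n / ∑ n ∈ B', a n else 0, ⟨fun n => ?_,
    fun n hn => if_neg hn, ?_, fun G hAG => ?_⟩, hB.subset (image_subset_image (filter_subset _ _)),
    fun n hn => (mem_filter.1 hn).2⟩
  · split_ifs
    exacts [div_nonneg (ha n) hs0'.le, le_rfl]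
  · rw [sum_congr rfl fun n hn => if_pos hn, ← sum_div, div_self hs0'.ne']
  · rw [← sum_filter, ← sum_div, div_le_iff₀ hs0']
    have h1 := hG {n ∈ G | n ∈ B'} (fun n hn => (mem_filter.1 (mem_filter.1 hn).2).1)
      (hAG.subset (filter_subset _ _))
    have h2 : 2 ≤ ε * K := by
      have : (0 : ℝ) ≤ #F := Nat.cast_nonneg _
      rw [hK, mul_add, mul_div_cancel₀ _ hε.ne']
      nlinarith
    have h3 : K * ∑ n ∈ G with n ∈ B', a n ≤ K * (ε * ∑ n ∈ B', a n) := by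
      nlinarith
    exact le_of_mul_le_mul_left h3 hK0

/-- Boundedness passes from `S_{N+1}` to `S_N`. If it failed for `S_N`, there would be averages
`a_1, a_2, …`, smaller and smaller in the norm of `S_N`, whose images under `ψ` are supported by
successive sets in `S_N`. In the norm of `S_{N+1}` they behave like the basis of `c_0`, but their
images like the basis of `ℓ_1`. -/
theorem IsBoundedMap.of_succ {w v ψ : ℕ → ℕ} {N : ℕ} (hw : ∀ n, 1 ≤ w n) (hv : ∀ n, n < v n)
    (h : IsBoundedMap w v ψ (N + 1)) : IsBoundedMap w v ψ N := by
  by_contra hcon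
  have hex := exists_isSmallAverage_of_not_isBoundedMap hw
    (h.finite_fiber fun n => (Nat.succ_le_of_lt ((Nat.zero_le n).trans_lt (hv n)))) hcon
  obtain ⟨K, hK, h⟩ := h
  -- `R` bounds the points of the images from below, and will be taken equal to the number `r` of
  -- averages, so that the union of the `r` images is in `S_{N+1}`.
  have key : ∀ R r : ℕ, ∀ c : ℝ, 1 < c → ∃ (X : Finset ℕ) (x : ℕ → ℝ) (b : ℕ → ℕ),
      (∀ n, 0 ≤ x n) ∧ (∀ n, n ∉ X → x n = 0) ∧ ∑ n ∈ X, x n = r ∧ NormLE w (N + 1) x c ∧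
      (∀ n ∈ X.image ψ, b n < r) ∧ (∀ n ∈ X.image ψ, R ≤ n) ∧ MonotoneOn b (X.image ψ) ∧
      ∀ t, Adm v N {n ∈ X.image ψ | b n = t} := by
    intro R r
    induction r with
    | zero =>
      exact fun c hc => ⟨∅, fun _ => 0, id, fun _ => le_rfl, fun _ _ => rfl, by simp,
        normLE_zero w _ hc, by simp, by simp, by simp [MonotoneOn], fun t =>
        Adm.of_card_le_one (fun n => (Nat.succ_le_of_lt ((Nat.zero_le n).trans_lt (hv n)))) N
          (by simp)⟩
    | succ r ihr =>
      intro c hc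
      obtain ⟨X, x, b, x1, x2, x3, x4, b1, b2, b3, b4⟩ := ihr ((1 + c) / 2) (by linarith)
      obtain ⟨ε, hε, hadd⟩ := exists_normLE_add x2 (by linarith) x4
        (show 0 < (c - 1) / 2 by linarith)
      obtain ⟨B, a, ha, hB, hBR⟩ := hex (max R ((X.image ψ).sup id + 1)) hε
      have hnew : ∀ n ∈ B.image ψ, R ≤ n ∧ ∀ m ∈ X.image ψ, m < n := by
        intro n hn
        obtain ⟨m, hm, rfl⟩ := mem_image.1 hn
        have := hBR m hm
        rw [max_le_iff] at this
        exact ⟨this.1, fun l hl => Nat.lt_of_succ_le ((Nat.succ_le_succ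
          (le_sup (f := id) hl)).trans this.2)⟩
      refine ⟨X ∪ B, fun n => x n + a n, fun n => if n ∈ X.image ψ then b n else r,
        fun n => add_nonneg (x1 n) (ha.nonneg n), fun n hn => ?_, ?_, ?_, ?_, ?_, ?_, fun t => ?_⟩
      · rw [notMem_union] at hn
        simp only [x2 n hn.1, ha.eq_zero n hn.2, add_zero]
      · rw [sum_union_add x2 ha.eq_zero, x3, ha.sum_eq]
        push_cast
        rfl
      · convert hadd B a ha using 1
        ring
      · intro n _
        dsimp only
        split_ifs with hn
        · exact (b1 n hn).trans (Nat.lt_succ_self r)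
        · exact Nat.lt_succ_self r
      · intro n hn
        rw [image_union, mem_union] at hn
        exact hn.elim (b2 n) fun hn => (hnew n hn).1
      · intro m hm n hn hmn
        rw [image_union, coe_union] at hm hn
        dsimp only
        by_cases hnX : n ∈ X.image ψ
        · have hmX : m ∈ X.image ψ := by
            by_contra hmX
            have hmB : m ∈ B.image ψ := hm.resolve_left hmX
            exact absurd ((hnew m hmB).2 n hnX) (not_lt.2 hmn)
          rw [if_pos hmX, if_pos hnX]
          exact b3 hmX hnX hmn
        · rw [if_neg hnX]
          split_ifs with hmX
          exacts [(b1 m hmX).le, le_rfl]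
      · by_cases ht : t = r
        · refine hB.subset fun n hn => ?_
          rw [mem_filter, image_union, mem_union] at hn
          by_contra hnB
          have hnX := hn.1.resolve_right hnB
          simp only [if_pos hnX] at hn
          exact absurd (b1 n hnX) (by omega)
        · refine (b4 t).subset fun n hn => ?_
          rw [mem_filter] at hn ⊢
          by_cases hnX : n ∈ X.image ψ
          · simp only [if_pos hnX] at hn
            exact ⟨hnX, hn.2⟩
          · simp only [if_neg hnX] at hn
            exact absurd hn.2.symm ht
  obtain ⟨r, hr⟩ := exists_nat_gt (K * 2)
  obtain ⟨X, x, b, x1, x2, x3, x4, b1, b2, b3, b4⟩ := key r r 2 one_lt_two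
  obtain ⟨G, -, hG, hle⟩ := h X ⟨r, b, b1, fun n hn => (b2 n hn).trans (hv n).le, b3, b4⟩ x x1
  rw [x3] at hle
  have := hle.trans (mul_le_mul_of_nonneg_left (x4 G hG) hK)
  linarith

theorem IsBoundedMap.of_le {w v ψ : ℕ → ℕ} {N N' : ℕ} (hw : ∀ n, 1 ≤ w n) (hv : ∀ n, n < v n)
    (hN : N' ≤ N) (h : IsBoundedMap w v ψ N) : IsBoundedMap w v ψ N' := by
  induction N, hN using Nat.le_induction with
  | base => exact h
  | succ N _ ih => exact ih (h.of_succ hw hv)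

/-- The case `N = 0`: the fibres of `ψ` have bounded size. -/
theorem IsBoundedMap.exists_card_le {w v ψ : ℕ → ℕ} (h : IsBoundedMap w v ψ 0) :
    ∃ M : ℕ, ∀ (u : ℕ) (B : Finset ℕ), (∀ n ∈ B, ψ n = u) → #B ≤ M := by
  obtain ⟨K, hK, h⟩ := h
  obtain ⟨M, hM⟩ := exists_nat_ge K
  refine ⟨M, fun u B hB => ?_⟩
  obtain ⟨G, -, hG, hle⟩ := h B (card_le_one.2 fun x hx y hy => by
    obtain ⟨x, hx', rfl⟩ := mem_image.1 hx
    obtain ⟨y, hy', rfl⟩ := mem_image.1 hy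
    exact (hB x hx').trans (hB y hy').symm) (fun _ => 1) fun _ => zero_le_one
  simp only [sum_const, nsmul_eq_mul, mul_one] at hle
  have hG1 : (#G : ℝ) ≤ 1 := by exact_mod_cast (show #G ≤ 1 from hG)
  have : (#B : ℝ) ≤ M := by nlinarith
  exact_mod_cast this

/-! ### Bounded maps of indices and domination -/

/-- Let `A` be cut into successive pieces, the fibres of `c`, the piece of `p` having `p` as its
first point. Pushing every piece to the left until it is an interval that starts at `p` gives a
strictly monotone map `τ`. If `f` carries points `x` of `A` to values `f x ≥ c x`, then these
values are not further to the left, as a set, than `τ A` is. -/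
theorem exists_compression {A : Finset ℕ} {c : ℕ → ℕ} (hc : MonotoneOn c A)
    (hcA : ∀ x ∈ A, c x ∈ A) (hle : ∀ x ∈ A, c x ≤ x) (hcc : ∀ x ∈ A, c (c x) = c x) :
    ∃ τ : ℕ → ℕ, StrictMonoOn τ A ∧ (∀ x ∈ A, c x ≤ τ x) ∧ (∀ x ∈ A, τ x ≤ x) ∧
      ∀ (C : Finset ℕ) (f : ℕ → ℕ), C ⊆ A → (∀ x ∈ C, c x ≤ f x) →
        ∀ y, #{v ∈ C.image f | v < y} ≤ #{v ∈ A.image τ | v < y} := by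
  set ρ : ℕ → ℕ := fun x => #{y ∈ {y ∈ A | c y = c x} | y < x} with hρ
  have hτ : ∀ x ∈ A, c x + ρ x ≤ x := by
    intro x hx
    have : ρ x ≤ #(Ico (c x) x) := card_le_card fun y hy => by
      rw [mem_filter, mem_filter] at hy
      exact mem_Ico.2 ⟨hy.1.2 ▸ hle y hy.1.1, hy.2⟩
    rw [Nat.card_Ico] at this
    have := hle x hx
    omega
  -- A piece ends before the first point of the next one.
  have hsep : ∀ x ∈ A, ∀ y ∈ A, c x < c y → x < c y := by
    intro x hx y hy hxy
    by_contra hcon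
    have := hc (hcA y hy) hx (not_lt.1 hcon)
    rw [hcc y hy] at this
    omega
  have hmono : StrictMonoOn (fun x => c x + ρ x) A := by
    intro x hx y hy hxy
    rcases (hc hx hy hxy.le).eq_or_lt with h | h
    · have := rank_strictMonoOn {z ∈ A | c z = c x} (mem_filter.2 ⟨hx, rfl⟩)
        (mem_filter.2 ⟨hy, h.symm⟩) hxy
      simp only [hρ, ← h] at this ⊢
      omega
    · have h1 := hτ x hx
      have h2 := hsep x hx y hy h
      dsimp only
      omega
  refine ⟨fun x => c x + ρ x, hmono, fun x _ => Nat.le_add_right _ _, hτ, ?_⟩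
  intro C f hC hf y
  rcases {v ∈ C.image f | v < y}.eq_empty_or_nonempty with hemp | hne
  · rw [hemp, card_empty]
    exact Nat.zero_le _
  have hne' : {p ∈ A.image c | p < y}.Nonempty := by
    obtain ⟨v, hv⟩ := hne
    obtain ⟨hv, hvy⟩ := mem_filter.1 hv
    obtain ⟨x, hx, rfl⟩ := mem_image.1 hv
    exact ⟨c x, mem_filter.2 ⟨mem_image_of_mem c (hC hx), (hf x hx).trans_lt hvy⟩⟩
  -- `p` is the last first point of a piece before `y`.
  obtain ⟨p, hp, hpmax⟩ := exists_max_image _ id hne'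
  obtain ⟨hpA, hpy⟩ := mem_filter.1 hp
  obtain ⟨q, hq, rfl⟩ := mem_image.1 hpA
  set S := {x ∈ A | c x = c q} with hS
  set D := {x ∈ A | c x < c q} with hD
  calc #{v ∈ C.image f | v < y}
      ≤ #(D.image f ∪ {v ∈ S.image f | c q ≤ v ∧ v < y}) := by
        refine card_le_card fun v hv => ?_
        obtain ⟨hv, hvy⟩ := mem_filter.1 hv
        obtain ⟨x, hx, rfl⟩ := mem_image.1 hv
        have hxq : c x ≤ c q := hpmax (c x)
          (mem_filter.2 ⟨mem_image_of_mem c (hC hx), (hf x hx).trans_lt hvy⟩)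
        rw [mem_union]
        rcases hxq.lt_or_eq with h | h
        · exact Or.inl (mem_image_of_mem f (mem_filter.2 ⟨hC hx, h⟩))
        · exact Or.inr (mem_filter.2 ⟨mem_image_of_mem f (mem_filter.2 ⟨hC hx, h⟩),
            h ▸ hf x hx, hvy⟩)
    _ ≤ #D + min #S (y - c q) := by
        refine (card_union_le _ _).trans (Nat.add_le_add card_image_le (le_min ?_ ?_))
        · exact (card_le_card (filter_subset _ _)).trans card_image_le
        · rw [← Nat.card_Ico]
          exact card_le_card fun v hv => mem_Ico.2 (mem_filter.1 hv).2
    _ ≤ #D + #{x ∈ S | #{z ∈ S | z < x} < y - c q} :=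
        Nat.add_le_add_left (le_card_rank_lt S _) _
    _ = #(D ∪ {x ∈ S | #{z ∈ S | z < x} < y - c q}) := by
        refine (card_union_of_disjoint (disjoint_left.2 fun x hx hx' => ?_)).symm
        have h1 := (mem_filter.1 hx).2
        have h2 := (mem_filter.1 (mem_filter.1 hx').1).2
        omega
    _ ≤ #({x ∈ A | c x + ρ x < y}.image fun x => c x + ρ x) := by
        rw [card_image_of_injOn (hmono.injOn.mono (coe_subset.2 (filter_subset _ _)))]
        refine card_le_card fun x hx => ?_
        rw [mem_union] at hx
        rcases hx with hx | hx
        · obtain ⟨hxA, hx⟩ := mem_filter.1 hx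
          exact mem_filter.2 ⟨hxA, (hτ x hxA).trans_lt ((hsep x hxA q hq hx).trans hpy)⟩
        · obtain ⟨hx, hxy⟩ := mem_filter.1 hx
          obtain ⟨hxA, hxq⟩ := mem_filter.1 hx
          refine mem_filter.2 ⟨hxA, ?_⟩
          simp only [hS] at hxy
          simp only [hρ, hxq]
          omega
    _ = #{v ∈ A.image fun x => c x + ρ x | v < y} := by
        rw [filter_image]

/-- A set that is cut into successive pieces, the piece of `p` lying to the right of `p` and having
at most `M * w p` elements, is good for `S_{N+1}` if the set of the `p` is good for `S_N`. -/
theorem Good.of_blocks {w : ℕ → ℕ} (hw : Monotone w) {N : ℕ} {K : ℝ} (hK : 0 ≤ K)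
    {P R : Finset ℕ} {c : ℕ → ℕ} (hP : Good w N K P) (hc : MonotoneOn c R) (hm : ∀ x ∈ R, c x ∈ P)
    (hle : ∀ x ∈ R, c x ≤ x) {M : ℕ} (hM : ∀ p ∈ P, #{x ∈ R | c x = p} ≤ M * w p) :
    Good w (N + 1) (K * M) R := by
  intro a ha
  choose! T hT hTc hTs using fun p hp => exists_subset_sum_le ha (w p) M (hM p hp)
  obtain ⟨G, hG, hG1, hG2⟩ := hP (fun p => ∑ x ∈ R with c x = p, a x)
    fun p => sum_nonneg fun n _ => ha n
  rw [sum_fiberwise_of_maps_to hm] at hG2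
  have hTR : ∀ p ∈ G, ∀ x ∈ T p, x ∈ R ∧ c x = p := fun p hp x hx =>
    mem_filter.1 (hT p (hG hp) hx)
  have hfib : ∀ p ∈ G, {x ∈ G.biUnion T | c x = p} = T p := by
    intro p hp
    ext x
    rw [mem_filter, mem_biUnion]
    constructor
    · rintro ⟨⟨q, hq, hx⟩, rfl⟩
      rwa [(hTR q hq x hx).2]
    · exact fun hx => ⟨⟨p, hp, hx⟩, (hTR p hp x hx).2⟩
  have hmG : ∀ x ∈ G.biUnion T, x ∈ R ∧ c x ∈ G := fun x hx => by
    obtain ⟨p, hp, hx⟩ := mem_biUnion.1 hx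
    obtain ⟨h1, h2⟩ := hTR p hp x hx
    exact ⟨h1, h2 ▸ hp⟩
  refine ⟨G.biUnion T, fun x hx => (hmG x hx).1, hG1.of_blocks hw
    (hc.mono fun x hx => (hmG x hx).1) (fun x hx => (hmG x hx).2)
    (fun x hx => hle x (hmG x hx).1) (fun p hp => ?_), hG2.trans ?_⟩
  · rw [hfib p hp]
    exact hTc p (hG hp)
  · rw [mul_assoc, ← sum_fiberwise_of_maps_to (g := c) fun x hx => (hmG x hx).2]
    refine mul_le_mul_of_nonneg_left ?_ hK
    rw [mul_sum]
    refine sum_le_sum fun p hp => ?_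
    rw [hfib p hp]
    exact hTs p (hG hp)

/-- If some map `ψ` of the indices, whatever it does to their order, induces a bounded map from the
sequence along `w` to the sequence along `v`, then the sequence along `w` dominates the sequence
along `v`.

A set `A` in `S_{N+1}` (along `v`) is cut into pieces, of at most `v p` elements each, whose first
points `p` form a set in `S_N`. The points of the compressed pieces that `ψ` does not carry to the
left of `p` are mapped to a set in `S_{N+1}`, so they are good by assumption, and so are the points
of `A`, which are further to the right. As the fibres of `ψ` have at most `M` points, there are at
most `M * p` other points in the piece of `p`, and these are good by induction. -/
theorem IsBoundedMap.exists_good {w v ψ : ℕ → ℕ} {N : ℕ} (hw : StrictMono w) (hv : StrictMono v)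
    (hw1 : ∀ n, n < w n) (hv1 : ∀ n, n < v n) (h : IsBoundedMap w v ψ N) :
    ∃ K : ℝ, 0 ≤ K ∧ ∀ A, Adm v N A → Good w N K A := by
  have hw1' : ∀ n, 1 ≤ w n := fun n => Nat.succ_le_of_lt ((Nat.zero_le n).trans_lt (hw1 n))
  induction N with
  | zero =>
    refine ⟨1, zero_le_one, fun A hA => ?_⟩
    have := Good.of_card_le hw1' 0 (show #A ≤ 1 from hA)
    rwa [Nat.cast_one] at this
  | succ N ih =>
    obtain ⟨K, hK, hD⟩ := ih (h.of_succ hw1' hv1)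
    obtain ⟨M, hM⟩ := (h.of_le hw1' hv1 (Nat.zero_le _)).exists_card_le
    obtain ⟨L, hL, h⟩ := h
    refine ⟨L + K * M, by positivity, fun A hA => ?_⟩
    obtain ⟨c, hc, hcA, hle, hcc, hP, hcard⟩ := hA.exists_blocks
    obtain ⟨τ, hτ, hcτ, hτle, hcount⟩ := exists_compression hc hcA hle hcc
    have hcτ' : ∀ x ∈ A, ∀ p ∈ A.image c, p ≤ τ x → p ≤ c x := by
      intro x hx p hp hpx
      obtain ⟨q, hq, rfl⟩ := mem_image.1 hp
      have := hc (hcA q hq) hx (hpx.trans (hτle x hx))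
      rwa [hcc q hq] at this
    -- The first point of the compressed piece that contains `y`.
    set c' : ℕ → ℕ := fun y => {p ∈ A.image c | p ≤ y}.sup id with hc'
    have hc'τ : ∀ x ∈ A, c' (τ x) = c x := by
      intro x hx
      refine le_antisymm (Finset.sup_le fun p hp => ?_) (le_sup (f := id) ?_)
      · rw [mem_filter] at hp
        exact hcτ' x hx p hp.1 hp.2
      · exact mem_filter.2 ⟨mem_image_of_mem c hx, hcτ x hx⟩
    have hτA : Adm v (N + 1) (A.image τ) := by
      refine hP.of_blocks hv.monotone (c := c') (fun x _ y _ hxy => ?_) ?_ ?_ ?_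
      · exact sup_mono (monotone_filter_right _ fun p _ hp => hp.trans hxy)
      · intro y hy
        obtain ⟨x, hx, rfl⟩ := mem_image.1 hy
        rw [hc'τ x hx]
        exact mem_image_of_mem c hx
      · intro y hy
        obtain ⟨x, hx, rfl⟩ := mem_image.1 hy
        rw [hc'τ x hx]
        exact hcτ x hx
      · intro p hp
        obtain ⟨q, hq, rfl⟩ := mem_image.1 hp
        refine le_trans ?_ (hcard (c q) (hcA q hq))
        refine (card_le_card fun y hy => ?_).trans (card_image_le (f := τ))
        obtain ⟨hy, hyq⟩ := mem_filter.1 hy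
        obtain ⟨x, hx, rfl⟩ := mem_image.1 hy
        rw [hc'τ x hx] at hyq
        exact mem_image_of_mem τ (mem_filter.2 ⟨hx, hyq⟩)
    set C := {x ∈ A | c x ≤ ψ (τ x)} with hC
    set R := {x ∈ A | ¬ c x ≤ ψ (τ x)} with hR
    have hCA : C ⊆ A := filter_subset _ _
    have hRA : R ⊆ A := filter_subset _ _
    have hCgood : Good w (N + 1) L C := by
      obtain ⟨θ, hθ, hθm, hθle⟩ := exists_strictMonoOn_of_count_le
        (hcount C (ψ ∘ τ) hCA fun x hx => (mem_filter.1 hx).2)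
      have := hτA.spread hv.monotone hθ hθm hθle
      rw [← image_image] at this
      exact (h _ this).spread hw.monotone (hτ.mono (coe_subset.2 hCA))
        (fun x hx => mem_image_of_mem τ hx) fun x hx => hτle x (hCA hx)
    have hRgood : Good w (N + 1) (K * M) R := by
      refine (hD _ hP).of_blocks hw.monotone hK (hc.mono (coe_subset.2 hRA))
        (fun x hx => mem_image_of_mem c (hRA hx)) (fun x hx => hle x (hRA hx)) fun p _ => ?_
      refine le_trans ?_ (Nat.mul_le_mul_left M (hw1 p).le)
      rw [← card_image_of_injOn (f := τ) (hτ.injOn.mono (coe_subset.2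
        ((filter_subset _ _).trans hRA)))]
      refine (card_le_mul_card_image_of_maps_to (f := ψ) (t := range p) (fun y hy => ?_) M
        fun u _ => hM u _ fun n hn => (mem_filter.1 hn).2).trans_eq ?_
      · obtain ⟨x, hx, rfl⟩ := mem_image.1 hy
        obtain ⟨hx', rfl⟩ := mem_filter.1 hx
        exact mem_range.2 (not_le.1 (mem_filter.1 hx').2)
      · rw [card_range]
    rw [← filter_union_filter_not_eq (fun x => c x ≤ ψ (τ x)) A]
    exact hCgood.union hL (by positivity) hRgood

/-! ### Comparison with the Schreier families -/

theorem adm_of_mem_family {i : ℕ → ℕ+} (hi : StrictMono i) {N : ℕ} {F : Finset ℕ+}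
    (hF : F ∈ family N) {A : Finset ℕ} (hA : ∀ n ∈ A, i n ∈ F) :
    Adm (fun n => (i n : ℕ)) N A := by
  induction N generalizing F A with
  | zero =>
    refine card_le_one.2 fun x hx y hy => hi.injective ?_
    rcases hF with rfl | ⟨m, rfl⟩
    · exact absurd (hA x hx) (notMem_empty _)
    · rw [mem_singleton.1 (hA x hx), mem_singleton.1 (hA y hy)]
  | succ N ih =>
    rcases hF with rfl | ⟨k, E, h1, h2, h3, h4, rfl⟩
    · have : A = ∅ := eq_empty_of_forall_notMem fun n hn => notMem_empty _ (hA n hn)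
      subst this
      exact Adm.of_card_le_one (fun n => (i n).pos) _ (by simp)
    have hE : ∀ n, ∃ t : ℕ, n ∈ A → ∃ ht : t < k, i n ∈ E ⟨t, ht⟩ := by
      intro n
      by_cases hn : n ∈ A
      · obtain ⟨t, -, ht⟩ := mem_biUnion.1 (hA n hn)
        exact ⟨t, fun _ => ⟨t.2, ht⟩⟩
      · exact ⟨0, fun h => absurd h hn⟩
    choose b hb using hE
    refine ⟨k, b, fun n hn => (hb n hn).1, fun n hn => h3 _ _ (hb n hn).2, ?_, fun t => ?_⟩
    · intro x hx y hy hxy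
      by_contra hlt
      obtain ⟨hbx, hx'⟩ := hb x hx
      obtain ⟨hby, hy'⟩ := hb y hy
      have := h4 ⟨b y, hby⟩ ⟨b x, hbx⟩ (not_le.1 hlt) _ hy' _ hx'
      exact absurd (hi.lt_iff_lt.1 this) (not_lt.2 hxy)
    · by_cases ht : t < k
      · refine ih (h1 ⟨t, ht⟩) fun n hn => ?_
        obtain ⟨hn', rfl⟩ := mem_filter.1 hn
        exact (hb n hn').2
      · refine Adm.of_card_le_one (fun n => (i n).pos) _ ?_
        rw [filter_false_of_mem fun n hn h => ht (lt_of_eq_of_lt (Eq.symm h) (hb n hn).1)]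
        simp

theorem Adm.image_mem_family {i : ℕ → ℕ+} (hi : StrictMono i) {N : ℕ} {A : Finset ℕ}
    (hA : Adm (fun n => (i n : ℕ)) N A) : A.image i ∈ family N := by
  induction N generalizing A with
  | zero =>
    rcases A.eq_empty_or_nonempty with rfl | ⟨x, hx⟩
    · exact Or.inl (image_empty _)
    · refine Or.inr ⟨i x, ?_⟩
      have : A = {x} := eq_singleton_iff_unique_mem.2 ⟨hx, fun y hy => card_le_one.1 hA y hy x hx⟩
      rw [this, image_singleton]
  | succ N ih =>
    obtain ⟨k, b, h1, h2, h3, h4⟩ := hA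
    -- Only the values that `b` takes correspond to non-empty pieces.
    set T := A.image b with hT
    have hcard : #T ≤ k := by
      rw [← card_range k]
      refine card_le_card fun t ht => ?_
      obtain ⟨n, hn, rfl⟩ := mem_image.1 ht
      exact mem_range.2 (h1 n hn)
    refine Or.inr ⟨#T, fun s => {n ∈ A | b n = T.orderEmbOfFin rfl s}.image i, fun s => ih (h4 _),
      fun s => ?_, fun s m hm => ?_, fun s s' hs x hx y hy => ?_, ?_⟩
    · obtain ⟨n, hn, h⟩ := mem_image.1 (T.orderEmbOfFin_mem rfl s)
      exact ⟨i n, mem_image_of_mem i (mem_filter.2 ⟨hn, h⟩)⟩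
    · obtain ⟨n, hn, rfl⟩ := mem_image.1 hm
      exact hcard.trans (h2 n (mem_filter.1 hn).1)
    · obtain ⟨m, hm, rfl⟩ := mem_image.1 hx
      obtain ⟨n, hn, rfl⟩ := mem_image.1 hy
      obtain ⟨hmA, hm⟩ := mem_filter.1 hm
      obtain ⟨hnA, hn⟩ := mem_filter.1 hn
      refine hi (not_le.1 fun hle => ?_)
      have h := h3 hnA hmA hle
      rw [hm, hn] at h
      exact absurd ((T.orderEmbOfFin rfl).lt_iff_lt.2 hs) (not_lt.2 h)
    · ext m
      simp only [mem_image, mem_biUnion, mem_univ, true_and, mem_filter]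
      constructor
      · rintro ⟨n, hn, rfl⟩
        have : b n ∈ Set.range (T.orderEmbOfFin rfl) := by
          rw [range_orderEmbOfFin]
          exact mem_coe.2 (mem_image_of_mem b hn)
        obtain ⟨s, hs⟩ := this
        exact ⟨s, n, ⟨hn, hs.symm⟩, rfl⟩
      · rintro ⟨s, n, ⟨hn, -⟩, rfl⟩
        exact ⟨n, hn, rfl⟩

/-! ### Coordinates and norms in the Schreier space -/

/-- The coordinate functionals on `c_00`. -/
noncomputable def coordHom (N : ℕ) (n : ℕ+) : C00 N →ₗ[ℝ] ℝ where
  toFun x := x.coord n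
  map_add' _ _ := rfl
  map_smul' _ _ := rfl

theorem coordHom_single (N : ℕ) (n m : ℕ+) :
    coordHom N m (C00.single N n) = if n = m then 1 else 0 := by
  change (C00.single N n).coord m = _
  rw [C00.coord, C00.single, LinearEquiv.apply_symm_apply, Finsupp.single_apply]

/-- The coordinate functionals on `X[S_N]`, the continuous extensions of those on `c_00`. -/
noncomputable def coordL (N : ℕ) (n : ℕ+) : Space N →L[ℝ] ℝ := (coordHom N n).extendOfNorm (incl N)

theorem coordL_incl {N : ℕ} (n : ℕ+) (x : C00 N) : coordL N n (incl N x) = x.coord n :=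
  LinearMap.extendOfNorm_eq (denseRange_incl N) ⟨1, fun y => by
    rw [norm_incl, one_mul]
    exact abs_coord_le_norm y n⟩ x

theorem sum_abs_coordL_le_norm {N : ℕ} {A : Finset ℕ+} (hA : A ∈ family N) (x : Space N) :
    ∑ n ∈ A, |coordL N n x| ≤ ‖x‖ := by
  refine (denseRange_incl N).induction_on (p := fun x => ∑ n ∈ A, |coordL N n x| ≤ ‖x‖) x
    (isClosed_le (by fun_prop) (by fun_prop)) fun y => ?_
  simp only [coordL_incl, norm_incl]
  exact sum_le_norm y hA

theorem abs_coordL_le_norm {N : ℕ} (n : ℕ+) (x : Space N) : |coordL N n x| ≤ ‖x‖ := by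
  simpa using sum_abs_coordL_le_norm (singleton_mem_family N n) x

theorem coord_sum_single {N : ℕ} {i : ℕ → ℕ+} (B : Finset ℕ) (a : ℕ → ℝ) (m : ℕ+) :
    (∑ n ∈ B, a n • C00.single N (i n)).coord m = ∑ n ∈ B, if i n = m then a n else 0 := by
  change coordHom N m _ = _
  simp [map_sum, coordHom_single]

theorem incl_sum_single {N : ℕ} {i : ℕ → ℕ+} (B : Finset ℕ) (a : ℕ → ℝ) :
    incl N (∑ n ∈ B, a n • C00.single N (i n)) = ∑ n ∈ B, a n • unitVec N (i n) := by
  simp [map_sum, incl_single]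

theorem coord_sum_single_apply {N : ℕ} {i : ℕ → ℕ+} (hi : StrictMono i) {B : Finset ℕ}
    (a : ℕ → ℝ) (m : ℕ) :
    (∑ n ∈ B, a n • C00.single N (i n)).coord (i m) = if m ∈ B then a m else 0 := by
  rw [coord_sum_single]
  simp [hi.injective.eq_iff]

theorem sum_abs_le_norm_sum {N : ℕ} {i : ℕ → ℕ+} (hi : StrictMono i) {B G : Finset ℕ}
    (hGB : G ⊆ B) (hG : Adm (fun n => (i n : ℕ)) N G) (a : ℕ → ℝ) :
    ∑ n ∈ G, |a n| ≤ ‖∑ n ∈ B, a n • unitVec N (i n)‖ := by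
  rw [← incl_sum_single, norm_incl]
  refine le_trans (le_of_eq ?_) (sum_le_norm _ (hG.image_mem_family hi))
  rw [sum_image hi.injective.injOn]
  exact sum_congr rfl fun n hn => by rw [coord_sum_single_apply hi, if_pos (hGB hn)]

theorem norm_sum_le_of_adm {N : ℕ} {i : ℕ → ℕ+} (hi : StrictMono i) {B : Finset ℕ} {a : ℕ → ℝ}
    {c : ℝ} (h : ∀ G ⊆ B, Adm (fun n => (i n : ℕ)) N G → ∑ n ∈ G, |a n| ≤ c) :
    ‖∑ n ∈ B, a n • unitVec N (i n)‖ ≤ c := by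
  rw [← incl_sum_single, norm_incl]
  refine norm_le_of _ _ fun F hF => ?_
  rw [← sum_preimage i F hi.injective.injOn]
  · refine le_trans (le_of_eq ?_) (h {n ∈ F.preimage i hi.injective.injOn | n ∈ B}
      (fun n hn => (mem_filter.1 hn).2)
      (adm_of_mem_family hi hF fun n hn => mem_preimage.1 (mem_filter.1 hn).1))
    rw [sum_filter]
    refine sum_congr rfl fun n _ => ?_
    rw [coord_sum_single_apply hi]
    split_ifs <;> simp
  · intro m _ hm
    rw [coord_sum_single, sum_eq_zero, abs_zero]
    intro n _
    exact if_neg fun h => hm ⟨n, h⟩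

/-- The subsequences of the unit vector basis are weakly null. -/
theorem finite_lt_abs_apply_unitVec {N : ℕ} {i : ℕ → ℕ+} (hi : StrictMono i)
    (f : Space N →L[ℝ] ℝ) {δ : ℝ} (hδ : 0 < δ) : {n | δ < |f (unitVec N (i n))|}.Finite := by
  by_contra hinf
  obtain ⟨B, a, hB, ha⟩ := exists_isSmallAverage (fun n => (i n : ℕ)) N hinf
    (show 0 < δ / (‖f‖ + 1) by positivity)
  set s : ℕ → ℝ := fun n => SignType.sign (f (unitVec N (i n))) with hs
  have hnorm : ‖∑ n ∈ B, (s n * a n) • unitVec N (i n)‖ ≤ δ / (‖f‖ + 1) := by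
    refine norm_sum_le_of_adm hi fun G _ hG => (sum_le_sum fun n _ => ?_).trans (ha.normLE G hG)
    rw [abs_mul, abs_of_nonneg (ha.nonneg n)]
    refine mul_le_of_le_one_left (ha.nonneg n) ?_
    simp only [hs]
    rcases lt_trichotomy (f (unitVec N (i n))) 0 with h | h | h <;> simp [h]
  have hf : δ ≤ f (∑ n ∈ B, (s n * a n) • unitVec N (i n)) := by
    rw [map_sum, ← mul_one δ, ← ha.sum_eq, mul_sum]
    refine sum_le_sum fun n hn => ?_
    have : s n * f (unitVec N (i n)) = |f (unitVec N (i n))| := sign_mul_self _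
    rw [map_smul, smul_eq_mul, mul_right_comm, this]
    exact mul_le_mul_of_nonneg_right (hB hn).le (ha.nonneg n)
  have h1 := hf.trans ((le_abs_self _).trans (f.le_opNorm_of_le hnorm))
  rw [mul_div_assoc', le_div_iff₀ (by positivity)] at h1
  nlinarith

/-! ### Large matrix entries of bounded operators -/

/-- Random signs in the quadratic form of a matrix produce its trace on average. -/
theorem exists_sign_trace_le {ι : Type*} (U : Finset ι) (m : ι → ι → ℝ) :
    ∃ θ : ι → ℝ, (∀ u, |θ u| = 1) ∧
      ∑ u ∈ U, m u u ≤ ∑ u ∈ U, ∑ v ∈ U, θ u * θ v * m u v := by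
  classical
  induction U using Finset.induction_on with
  | empty => exact ⟨fun _ => 1, fun _ => abs_one, by simp⟩
  | insert p U hp ih =>
    obtain ⟨θ, hθ, h⟩ := ih
    set l := ∑ v ∈ U, θ v * m p v + ∑ u ∈ U, θ u * m u p with hl
    -- The sign at the new index `p` makes the cross terms nonnegative.
    obtain ⟨s, hs, hsl⟩ : ∃ s : ℝ, |s| = 1 ∧ 0 ≤ s * l := by
      rcases le_total 0 l with h | h
      · exact ⟨1, abs_one, by simpa⟩
      · exact ⟨-1, by simp, by simpa⟩
    refine ⟨Function.update θ p s, fun u => ?_, ?_⟩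
    · by_cases hu : u = p
      · simpa [hu]
      · simpa [hu] using hθ u
    · have hne : ∀ u ∈ U, Function.update θ p s u = θ u := fun u hu =>
        Function.update_of_ne (ne_of_mem_of_not_mem hu hp) _ _
      have hss : s * s = 1 := by
        rw [← abs_mul_abs_self, hs, one_mul]
      have e1 : ∀ u ∈ U, ∑ v ∈ insert p U, Function.update θ p s u * Function.update θ p s v * m u v
          = s * (θ u * m u p) + ∑ v ∈ U, θ u * θ v * m u v := by
        intro u hu
        rw [sum_insert hp, Function.update_self, hne u hu]
        congr 1
        · ring
        · exact sum_congr rfl fun v hv => by rw [hne v hv]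
      have e2 : ∑ v ∈ insert p U, Function.update θ p s p * Function.update θ p s v * m p v
          = m p p + s * ∑ v ∈ U, θ v * m p v := by
        rw [sum_insert hp, Function.update_self, hss, one_mul, mul_sum]
        congr 1
        exact sum_congr rfl fun v hv => by rw [hne v hv, mul_assoc]
      rw [sum_insert hp, sum_insert hp, e2, sum_congr rfl e1, sum_add_distrib, ← mul_sum]
      rw [hl, mul_add] at hsl
      linarith

/-- If the matrix entries of a bounded operator at the places `(j (ψ n), i n)` with `n ∈ B` are not
small, the passage from the `i n` to the `j (ψ n)` is bounded: choosing the signs of the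
coefficients of a vector at random, but equal up to normalization for all `n` with the same `ψ n`,
one removes the other entries of the matrix. -/
theorem good_of_le_abs_coordL {N : ℕ} {i j : ℕ → ℕ+} (hi : StrictMono i) (hj : StrictMono j)
    (β : Space N →L[ℝ] Space N) {ψ : ℕ → ℕ} {δ : ℝ} (hδ : 0 < δ) {B : Finset ℕ}
    (hB : ∀ n ∈ B, δ ≤ |coordL N (j (ψ n)) (β (unitVec N (i n)))|)
    (hadm : Adm (fun n => (j n : ℕ)) N (B.image ψ)) :
    Good (fun n => (i n : ℕ)) N (‖β‖ / δ) B := by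
  classical
  intro a ha
  obtain ⟨G, hG, hmax⟩ := exists_max_image {G ∈ B.powerset | Adm (fun n => (i n : ℕ)) N G}
    (fun G => ∑ n ∈ G, a n) ⟨∅, mem_filter.2 ⟨empty_mem_powerset _,
      Adm.of_card_le_one (fun n => (i n).pos) N (by simp)⟩⟩
  rw [mem_filter, mem_powerset] at hG
  refine ⟨G, hG.1, hG.2, ?_⟩
  set U := B.image ψ with hU
  set q : ℕ → ℕ → ℝ := fun u n => coordL N (j u) (β (unitVec N (i n))) with hq
  set s : ℕ → ℝ := fun n => SignType.sign (q (ψ n) n) with hs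
  obtain ⟨θ, hθ, htr⟩ := exists_sign_trace_le U fun u v => ∑ n ∈ B with ψ n = v, s n * a n * q u n
  set z := ∑ n ∈ B, (θ (ψ n) * s n * a n) • unitVec N (i n) with hz
  have hzn : ‖z‖ ≤ ∑ n ∈ G, a n := by
    refine norm_sum_le_of_adm hi fun F hFB hF => (sum_le_sum fun n _ => ?_).trans
      (hmax F (mem_filter.2 ⟨mem_powerset.2 hFB, hF⟩))
    rw [abs_mul, abs_mul, hθ, one_mul, abs_of_nonneg (ha n)]
    refine mul_le_of_le_one_left (ha n) ?_
    simp only [hs]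
    rcases lt_trichotomy (q (ψ n) n) 0 with h | h | h <;> simp [h]
  have hcoord : ∀ u, ∑ v ∈ U, θ u * θ v * ∑ n ∈ B with ψ n = v, s n * a n * q u n =
      θ u * coordL N (j u) (β z) := by
    intro u
    rw [hz, map_sum, map_sum, mul_sum,
      ← sum_fiberwise_of_maps_to (t := U) (g := ψ) fun n hn => mem_image_of_mem ψ hn]
    refine sum_congr rfl fun v _ => ?_
    rw [mul_sum]
    refine sum_congr rfl fun n hn => ?_
    rw [← (mem_filter.1 hn).2, map_smul, map_smul, smul_eq_mul]
    simp only [hq]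
    ring
  have hlow : δ * ∑ n ∈ B, a n ≤ ∑ u ∈ U, ∑ n ∈ B with ψ n = u, s n * a n * q u n := by
    rw [mul_sum, ← sum_fiberwise_of_maps_to (t := U) (g := ψ) fun n hn => mem_image_of_mem ψ hn]
    refine sum_le_sum fun u _ => sum_le_sum fun n hn => ?_
    obtain ⟨hnB, rfl⟩ := mem_filter.1 hn
    have : s n * q (ψ n) n = |q (ψ n) n| := sign_mul_self _
    rw [mul_right_comm, this]
    exact mul_le_mul_of_nonneg_right (hB n hnB) (ha n)
  have hup : ∑ u ∈ U, θ u * coordL N (j u) (β z) ≤ ‖β z‖ := by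
    have := sum_abs_coordL_le_norm (hadm.image_mem_family hj) (β z)
    rw [sum_image hj.injective.injOn] at this
    refine (sum_le_sum fun u _ => ?_).trans this
    refine (le_abs_self _).trans_eq ?_
    rw [abs_mul, hθ, one_mul]
  rw [sum_congr rfl fun u _ => hcoord u] at htr
  have := hlow.trans (htr.trans (hup.trans (β.le_opNorm_of_le hzn)))
  rw [div_mul_eq_mul_div, le_div_iff₀ hδ]
  linarith

/-- Each of the finitely many operators in `𝓑` accounts for the indices at which its matrix entry is
large, and the `m` first indices cost at most `m`. -/
theorem isBoundedMap_of_lt_abs_coordL {N : ℕ} {i j : ℕ → ℕ+} (hi : StrictMono i)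
    (hj : StrictMono j) (𝓑 : Finset (Space N →L[ℝ] Space N)) {ψ : ℕ → ℕ} {δ : ℝ} (hδ : 0 < δ)
    (m : ℕ)
    (h : ∀ n, m ≤ n → ∃ β ∈ 𝓑, δ < |coordL N (j (ψ n)) (β (unitVec N (i n)))|) :
    IsBoundedMap (fun n => (i n : ℕ)) (fun n => (j n : ℕ)) ψ N := by
  classical
  have hw : Monotone fun n => (i n : ℕ) := fun a b hab => hi.monotone hab
  have hw1 : ∀ n, 1 ≤ (i n : ℕ) := fun n => (i n).pos
  have hK : ∀ β : Space N →L[ℝ] Space N, 0 ≤ ‖β‖ / δ := fun β => by positivity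
  refine ⟨m + ∑ β ∈ 𝓑, ‖β‖ / δ, add_nonneg m.cast_nonneg (sum_nonneg fun β _ => hK β),
    fun B hB => ?_⟩
  have h1 := Good.of_card_le hw1 N (card_range m).le
  have h2 := Good.biUnion hw1 (N := N) 𝓑 hK (B := fun β =>
    {n ∈ B | δ < |coordL N (j (ψ n)) (β (unitVec N (i n)))|}) fun β _ =>
      good_of_le_abs_coordL hi hj β hδ (fun n hn => (mem_filter.1 hn).2.le)
        (hB.subset (image_subset_image (filter_subset _ _)))
  refine (h1.union m.cast_nonneg (sum_nonneg fun β _ => hK β) h2).subset hw fun n hn => ?_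
  rw [mem_union, mem_range, mem_biUnion]
  refine (lt_or_ge n m).imp id fun hmn => ?_
  obtain ⟨β, hβ, hlt⟩ := h n hmn
  exact ⟨β, hβ, mem_filter.2 ⟨hn, hlt⟩⟩

/-! ### The closed operator ideal generated by the `T_J` -/

/-- As `(e_n)` behaves like the basis of `c_0`, the norm of `T_J x` is at most a multiple of the
supremum of the coordinates of `x` with indices in `J`. -/
theorem norm_opT_le {N : ℕ} {e : ℕ+ → Space N} (he : IsEquivToC0Basis e) :
    ∃ C : ℝ, 0 ≤ C ∧ ∀ (J : Set ℕ+) (x : Space N) (c : ℝ), 0 ≤ c →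
      (∀ j ∈ J, |coordL N j x| ≤ c) → ‖opT N e J x‖ ≤ C * c := by
  classical
  obtain ⟨c₀, C, -, hC, h⟩ := he
  have hT : ∀ y : C00 N, opOfSeq N e (incl N y) =
      (C00.toFinsupp N y).sum fun n t => t • e n := fun y =>
    LinearMap.extendOfNorm_eq (denseRange_incl N) ⟨C, fun y => by
      rw [norm_incl]
      exact (h (C00.toFinsupp N y)).2 ‖y‖ (abs_coord_le_norm y)⟩ y
  have hincl : ∀ (J : Set ℕ+) (y : C00 N) (c : ℝ), 0 ≤ c →
      (∀ j ∈ J, |y.coord j| ≤ c) → ‖opT N e J (incl N y)‖ ≤ C * c := by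
    intro J y c hc hy
    rw [opT, ContinuousLinearMap.comp_apply, proj_incl, hT]
    refine (h _).2 c fun n => ?_
    change |(restrict N J y).coord n| ≤ c
    rw [restrict_coord]
    split_ifs with hn
    · exact hy n hn
    · rwa [abs_zero]
  refine ⟨C, hC.le, fun J x c hc hx => ?_⟩
  refine le_of_forall_pos_le_add fun η hη => ?_
  obtain ⟨y, hy⟩ := (denseRange_incl N).exists_dist_lt x
    (show 0 < η / (C + ‖opT N e J‖ + 1) by positivity)
  rw [dist_eq_norm] at hy
  have h1 : ‖opT N e J (incl N y)‖ ≤ C * (c + ‖x - incl N y‖) := by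
    refine hincl J y _ (by positivity) fun j hj => ?_
    have h2 := abs_coordL_le_norm j (x - incl N y)
    rw [map_sub, coordL_incl] at h2
    have h3 := abs_sub_abs_le_abs_sub (y.coord j) (coordL N j x)
    rw [abs_sub_comm] at h3
    linarith [hx j hj]
  have h2 : ‖opT N e J x‖ ≤ ‖opT N e J (incl N y)‖ + ‖opT N e J‖ * ‖x - incl N y‖ := by
    have h3 := (opT N e J).le_opNorm (x - incl N y)
    rw [map_sub] at h3
    linarith [norm_le_norm_add_norm_sub' (opT N e J x) (opT N e J (incl N y))]
  rw [lt_div_iff₀ (by positivity)] at hy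
  nlinarith [norm_nonneg (x - incl N y)]

theorem exists_functionals_of_finite_range {E : Type*} [NormedAddCommGroup E] [NormedSpace ℝ E]
    (F : E →L[ℝ] E) (hF : FiniteDimensional ℝ (LinearMap.range F.toLinearMap)) :
    ∃ (𝓕 : Finset (E →L[ℝ] ℝ)) (C : ℝ), 0 ≤ C ∧ ∀ (x : E) (c : ℝ), 0 ≤ c →
      (∀ f ∈ 𝓕, |f x| ≤ c) → ‖F x‖ ≤ C * c := by
  classical
  set V := LinearMap.range F.toLinearMap
  set b := Module.finBasis ℝ V
  let F' : E →L[ℝ] V := F.codRestrict V fun x => LinearMap.mem_range_self F.toLinearMap x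
  refine ⟨univ.image fun t => (LinearMap.toContinuousLinearMap (b.coord t)).comp F',
    ∑ t, ‖(b t : E)‖, sum_nonneg fun t _ => norm_nonneg _, fun x c _ h => ?_⟩
  have hx : F x = ∑ t, b.repr (F' x) t • (b t : E) := by
    have := congrArg (Subtype.val) (b.sum_repr (F' x))
    rw [Submodule.coe_sum] at this
    exact this.symm
  rw [hx, sum_mul]
  refine (norm_sum_le _ _).trans (sum_le_sum fun t _ => ?_)
  rw [norm_smul, mul_comm]
  exact mul_le_mul_of_nonneg_left (h _ (mem_image_of_mem _ (mem_univ t))) (norm_nonneg _)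

/-- The operators `R` such that, up to an error `ε * ‖x‖`, the norm of `R x` is controlled by
finitely many functionals of `x` and by the coordinates, with indices in finitely many members of
`𝒥`, of the images of `x` under finitely many bounded operators. -/
def IsControlled (N : ℕ) (𝒥 : Set (Set ℕ+)) (R : Space N →L[ℝ] Space N) : Prop :=
  ∀ ε > 0, ∃ (𝓑 : Finset (Space N →L[ℝ] Space N)) (𝒥₀ : Finset (Set ℕ+))
    (𝓕 : Finset (Space N →L[ℝ] ℝ)) (C : ℝ), 0 ≤ C ∧ (∀ J ∈ 𝒥₀, J ∈ 𝒥) ∧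
    ∀ (x : Space N) (c : ℝ), 0 ≤ c → (∀ β ∈ 𝓑, ∀ J ∈ 𝒥₀, ∀ j ∈ J, |coordL N j (β x)| ≤ c) →
      (∀ f ∈ 𝓕, |f x| ≤ c) → ‖R x‖ ≤ ε * ‖x‖ + C * c

/-- The controlled operators form a linear subspace. -/
def controlled (N : ℕ) (𝒥 : Set (Set ℕ+)) : Submodule ℝ (Space N →L[ℝ] Space N) where
  carrier := {R | IsControlled N 𝒥 R}
  zero_mem' ε hε := ⟨∅, ∅, ∅, 0, le_rfl, by simp, fun x c _ _ _ => by
    rw [zero_mul, add_zero, _root_.zero_apply, norm_zero]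
    positivity⟩
  add_mem' {R S} hR hS ε hε := by
    classical
    obtain ⟨𝓑₁, 𝒥₁, 𝓕₁, C₁, hC₁, h𝒥₁, h₁⟩ := hR (ε / 2) (by positivity)
    obtain ⟨𝓑₂, 𝒥₂, 𝓕₂, C₂, hC₂, h𝒥₂, h₂⟩ := hS (ε / 2) (by positivity)
    refine ⟨𝓑₁ ∪ 𝓑₂, 𝒥₁ ∪ 𝒥₂, 𝓕₁ ∪ 𝓕₂, C₁ + C₂, add_nonneg hC₁ hC₂,
      fun J hJ => (mem_union.1 hJ).elim (h𝒥₁ J) (h𝒥₂ J), fun x c hc hx hf => ?_⟩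
    have := h₁ x c hc (fun β hβ J hJ => hx β (mem_union_left _ hβ) J (mem_union_left _ hJ))
      fun f h => hf f (mem_union_left _ h)
    have := h₂ x c hc (fun β hβ J hJ => hx β (mem_union_right _ hβ) J (mem_union_right _ hJ))
      fun f h => hf f (mem_union_right _ h)
    have := norm_add_le (R x) (S x)
    rw [_root_.add_apply]
    linarith
  smul_mem' r R hR ε hε := by
    obtain ⟨𝓑, 𝒥₀, 𝓕, C, hC, h𝒥, h⟩ := hR (ε / (|r| + 1)) (by positivity)
    refine ⟨𝓑, 𝒥₀, 𝓕, |r| * C, by positivity, h𝒥, fun x c hc hx hf => ?_⟩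
    have h1 := mul_le_mul_of_nonneg_left (h x c hc hx hf) (abs_nonneg r)
    have h2 : |r| * (ε / (|r| + 1)) ≤ ε := by
      rw [mul_div_assoc', div_le_iff₀ (by positivity)]
      nlinarith
    have h3 := mul_le_mul_of_nonneg_right h2 (norm_nonneg x)
    rw [_root_.smul_apply, norm_smul, Real.norm_eq_abs]
    linarith

theorem isOperatorIdeal_controlled (N : ℕ) (𝒥 : Set (Set ℕ+)) :
    IsOperatorIdeal (controlled N 𝒥) where
  finiteRank_mem F hF ε hε := by
    obtain ⟨𝓕, C, hC, h⟩ := exists_functionals_of_finite_range F hF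
    refine ⟨∅, ∅, 𝓕, C, hC, by simp, fun x c hc _ hf => (h x c hc hf).trans ?_⟩
    have : 0 ≤ ε * ‖x‖ := by positivity
    linarith
  comp_mem_left A R hR ε hε := by
    obtain ⟨𝓑, 𝒥₀, 𝓕, C, hC, h𝒥, h⟩ := hR (ε / (‖A‖ + 1)) (by positivity)
    refine ⟨𝓑, 𝒥₀, 𝓕, ‖A‖ * C, by positivity, h𝒥, fun x c hc hx hf => ?_⟩
    have h1 := A.le_opNorm_of_le (h x c hc hx hf)
    have h2 : ‖A‖ * (ε / (‖A‖ + 1)) ≤ ε := by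
      rw [mul_div_assoc', div_le_iff₀ (by positivity)]
      nlinarith
    have h3 := mul_le_mul_of_nonneg_right h2 (norm_nonneg x)
    rw [ContinuousLinearMap.comp_apply]
    linarith
  comp_mem_right R A hR ε hε := by
    classical
    obtain ⟨𝓑, 𝒥₀, 𝓕, C, hC, h𝒥, h⟩ := hR (ε / (‖A‖ + 1)) (by positivity)
    refine ⟨𝓑.image fun β => β.comp A, 𝒥₀, 𝓕.image fun f => f.comp A, C, hC, h𝒥,
      fun x c hc hx hf => ?_⟩
    have h1 := h (A x) c hc (fun β hβ => hx _ (mem_image_of_mem _ hβ))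
      fun f h => hf _ (mem_image_of_mem _ h)
    have h2 := mul_le_mul_of_nonneg_left (A.le_opNorm x)
      (show 0 ≤ ε / (‖A‖ + 1) by positivity)
    have h3 : ε / (‖A‖ + 1) * ‖A‖ ≤ ε := by
      rw [div_mul_eq_mul_div, div_le_iff₀ (by positivity)]
      nlinarith
    have h4 := mul_le_mul_of_nonneg_right h3 (norm_nonneg x)
    rw [ContinuousLinearMap.comp_apply]
    linarith

theorem isClosed_controlled (N : ℕ) (𝒥 : Set (Set ℕ+)) :
    IsClosed (controlled N 𝒥 : Set (Space N →L[ℝ] Space N)) := by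
  refine isClosed_of_closure_subset fun R hR ε hε => ?_
  obtain ⟨S, hS, hRS⟩ := Metric.mem_closure_iff.1 hR (ε / 2) (by positivity)
  obtain ⟨𝓑, 𝒥₀, 𝓕, C, hC, h𝒥, h⟩ := hS (ε / 2) (by positivity)
  refine ⟨𝓑, 𝒥₀, 𝓕, C, hC, h𝒥, fun x c hc hx hf => ?_⟩
  have h1 := h x c hc hx hf
  rw [dist_eq_norm] at hRS
  have h2 := ((R - S).le_opNorm x).trans (mul_le_mul_of_nonneg_right hRS.le (norm_nonneg x))
  rw [_root_.sub_apply] at h2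
  linarith [norm_le_norm_add_norm_sub' (R x) (S x)]

theorem opT_mem_controlled {N : ℕ} {e : ℕ+ → Space N} (he : IsEquivToC0Basis e)
    {𝒥 : Set (Set ℕ+)} {J : Set ℕ+} (hJ : J ∈ 𝒥) : opT N e J ∈ controlled N 𝒥 := by
  intro ε hε
  obtain ⟨C, hC, h⟩ := norm_opT_le he
  refine ⟨{ContinuousLinearMap.id ℝ _}, {J}, ∅, C, hC, fun J' hJ' => mem_singleton.1 hJ' ▸ hJ,
    fun x c hc hx _ => (h J x c hc ?_).trans ?_⟩
  · exact hx _ (mem_singleton_self _) J (mem_singleton_self _)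
  · have : 0 ≤ ε * ‖x‖ := by positivity
    linarith

/-- Minimality of the closed operator ideal generated by the `T_J`. -/
theorem closedIdeal_le_controlled {N : ℕ} {e : ℕ+ → Space N} (he : IsEquivToC0Basis e)
    (𝒥 : Set (Set ℕ+)) :
    closedIdeal {R | ∃ J ∈ 𝒥, R = opT N e J} ≤ controlled N 𝒥 :=
  sInf_le ⟨isOperatorIdeal_controlled N 𝒥, isClosed_controlled N 𝒥, by
    rintro _ ⟨J, hJ, rfl⟩
    exact opT_mem_controlled he hJ⟩

/-! ### Domination and the distance to the ideal -/

theorem lt_coe_of_strictMono {i : ℕ → ℕ+} (hi : StrictMono i) (n : ℕ) : n < (i n : ℕ) := by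
  induction n with
  | zero => exact (i 0).pos
  | succ n ih => exact (Nat.succ_le_of_lt ih).trans_lt (hi (Nat.lt_succ_self n))

theorem IsBoundedMap.dominates {N : ℕ} {i j : ℕ → ℕ+} (hi : StrictMono i) (hj : StrictMono j)
    {ψ : ℕ → ℕ} (h : IsBoundedMap (fun n => (i n : ℕ)) (fun n => (j n : ℕ)) ψ N) :
    Dominates (fun n => unitVec N (i n)) (fun n => unitVec N (j n)) := by
  obtain ⟨K, hK, h⟩ := h.exists_good (fun a b hab => hi hab) (fun a b hab => hj hab)
    (lt_coe_of_strictMono hi) (lt_coe_of_strictMono hj)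
  refine ⟨K, fun a => norm_sum_le_of_adm hj fun A hA hadm => ?_⟩
  obtain ⟨G, hGA, hG, hle⟩ := h A hadm (fun n => |a n|) fun n => abs_nonneg _
  exact hle.trans (mul_le_mul_of_nonneg_left (sum_abs_le_norm_sum hi (hGA.trans hA) hG a) hK)

end

end Schreier

theorem proposition4 (N : ℕ) (hN : 1 ≤ N)
    (e : ℕ+ → Schreier.Space N) (he_norm : ∀ n, ‖e n‖ = 1) (he : Schreier.IsEquivToC0Basis e)
    (I : Set ℕ+) (hI : I.Infinite)
    (𝒥 : Set (Set ℕ+)) (h𝒥 : ∀ J ∈ 𝒥, J.Infinite)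
    (hdom : ∀ (k : ℕ) (J : Fin k → Set ℕ+), 1 ≤ k → (∀ t, J t ∈ 𝒥) →
      ¬ Schreier.Dominates (Schreier.subseq N I) (Schreier.subseq N (⋃ t, J t)))
    (Q : Schreier.Space N →L[ℝ] Schreier.Space N)
    (hQ : Q ∈ Schreier.closedIdeal {R | ∃ J ∈ 𝒥, R = Schreier.opT N e J}) :
    1 ≤ ‖Schreier.opT N e I - Q‖ := by
  classical
  by_contra hlt
  rw [not_le] at hlt
  obtain ⟨hi, hiI⟩ := Schreier.enum_strictMono_and_range hI
  set δ := 1 - ‖Schreier.opT N e I - Q‖ with hδ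
  have hδ0 : 0 < δ := sub_pos.2 hlt
  have hQn : ∀ n, δ ≤ ‖Q (Schreier.unitVec N (Schreier.enum I n))‖ := by
    intro n
    have hn : Schreier.enum I n ∈ I := hiI.le (Set.mem_range_self n)
    have h1 := (Schreier.opT N e I - Q).le_opNorm (Schreier.unitVec N (Schreier.enum I n))
    rw [_root_.sub_apply, Schreier.opT_unitVec he, if_pos hn, Schreier.norm_unitVec,
      mul_one] at h1
    have h2 := norm_le_norm_add_norm_sub' (e (Schreier.enum I n))
      (Q (Schreier.unitVec N (Schreier.enum I n)))
    rw [he_norm] at h2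
    linarith
  obtain ⟨𝓑, 𝒥₀, 𝓕, C, hC, h𝒥₀, hcontrol⟩ :=
    Schreier.closedIdeal_le_controlled he 𝒥 hQ (δ / 2) (by positivity)
  set c := δ / (4 * (C + 1)) with hc
  have hc0 : 0 < c := by positivity
  have hCc : C * c < δ / 2 := by
    rw [hc, mul_div_assoc', div_lt_iff₀ (by positivity)]
    nlinarith
  have hfin : (⋃ f ∈ 𝓕, {n | c < |f (Schreier.unitVec N (Schreier.enum I n))|}).Finite :=
    𝓕.finite_toSet.biUnion fun f _ => Schreier.finite_lt_abs_apply_unitVec hi f hc0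
  obtain ⟨m, hm⟩ := hfin.bddAbove
  -- The functionals in `𝓕` are small at all but finitely many of the `ẽ_i`, so at the other ones a
  -- coordinate has to be large.
  have hlarge : ∀ n, m + 1 ≤ n → ∃ β ∈ 𝓑, ∃ J ∈ 𝒥₀, ∃ j ∈ J,
      c < |Schreier.coordL N j (β (Schreier.unitVec N (Schreier.enum I n)))| := by
    intro n hn
    by_contra hcon
    push Not at hcon
    have := hcontrol _ c hc0.le hcon fun f hf => not_lt.1 fun h =>
      absurd (hm (Set.mem_biUnion hf h)) (not_le.2 hn)
    rw [Schreier.norm_unitVec] at this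
    linarith [hQn n]
  -- In particular `𝒥₀` is not empty.
  obtain ⟨-, -, J₁, hJ₁, -⟩ := hlarge (m + 1) le_rfl
  set J : Fin 𝒥₀.card → Set ℕ+ := fun t => (𝒥₀.equivFin.symm t : Set ℕ+) with hJ
  have hJ𝒥 : ∀ t, J t ∈ 𝒥 := fun t => h𝒥₀ _ (𝒥₀.equivFin.symm t).2
  have hsub : ∀ J' ∈ 𝒥₀, J' ⊆ ⋃ t, J t := by
    intro J' hJ'
    have : J (𝒥₀.equivFin ⟨J', hJ'⟩) = J' := by simp [hJ]
    exact this ▸ Set.subset_iUnion J _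
  obtain ⟨hj, hjJ⟩ := Schreier.enum_strictMono_and_range
    ((h𝒥 J₁ (h𝒥₀ J₁ hJ₁)).mono (hsub J₁ hJ₁))
  have hψ : ∀ n, ∃ l, m + 1 ≤ n → ∃ β ∈ 𝓑, c < |Schreier.coordL N
      (Schreier.enum (⋃ t, J t) l) (β (Schreier.unitVec N (Schreier.enum I n)))| := by
    intro n
    by_cases hn : m + 1 ≤ n
    · obtain ⟨β, hβ, J', hJ', j, hjJ', h⟩ := hlarge n hn
      obtain ⟨l, rfl⟩ := hjJ.ge (hsub J' hJ' hjJ')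
      exact ⟨l, fun _ => ⟨β, hβ, h⟩⟩
    · exact ⟨0, fun h => absurd h hn⟩
  choose ψ hψ using hψ
  exact hdom _ J (Finset.card_pos.2 ⟨J₁, hJ₁⟩) hJ𝒥
    ((Schreier.isBoundedMap_of_lt_abs_coordL hi hj 𝓑 hc0 (m + 1) hψ).dominates hi hj)
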